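/- Let $\beta,\delta$ be real polynomials that are nonnegative on $[0,1]$, with $\beta(1)=0$ and $\delta(0)=0$. For $N\ge 1$ consider the continuous-time Markov chain on $\{0,1,\dots,N\}$ with density dependent birth rates $\beta_k=N\beta(k/N)$ and death rates $\delta_k=N\delta(k/N)$; that is, $p(t)=(p_0(t),\dots,p_N(t))$ starts from a probability vector $p(0)$ and satisfies, for $t\ge0$ and $0\le k\le N$, the Kolmogorov equations $$\dot p_k=\beta_{k-1}p_{k-1}-(\beta_k+\delta_k)p_k+\delta_{k+1}p_{k+1}$$ (terms with index $-1$ or $N+1$ are absent). Write $\beta(x)-\delta(x)=\sum_{j=0}^{l}q_jx^j$ and assume $$q_0,q_2,\dots,q_l\ge 0,\quad q_1\le 0,\quad \sum_{j=0}^{l}q_j\le 0,\quad q_0-q_2-2q_3-\dots-(l-1)q_l\le 0 .$$ Denote the moments by $m_n(t)=\sum_{k=0}^N (k/N)^n p_k(t)$, and for $n\ge1$ put $$d_n(t)=\sum_{k=0}^N\Big(\beta_k\frac{(k+1)^n-k^n-nk^{n-1}}{N^{n-1}}+\delta_k\frac{(k-1)^n-k^n+nk^{n-1}}{N^{n-1}}\Big)p_k(t).$$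 Consider the infinite systems, for $n=1,2,\dots$, $$\text{(M)}\quad \dot y_n=n\sum_{j=0}^{l}q_j\,y_{n+j-1}+\tfrac1N d_n(t),\qquad\qquad \text{(IE)}\quad \dot f_n=n\sum_{j=0}^{l}q_j\,f_{n+j-1},$$ where $y_0\equiv f_0\equiv1$. For positive weights $w=(w_n)_{n\ge1}$ let $\ell^1_w$ be the Banach space of real sequences $x=(x_n)_{n\ge1}$ with $\|x\|_w=\sum_{n\ge1}w_n|x_n|<\infty$. A solution in $\ell^1_w$ on $[0,T]$ is a continuous function $[0,T]\to\ell^1_w$ each of whose coordinates is differentiable and satisfies its equation. **Theorem.** There are positive weights $w$, depending only on $\beta$ and $\delta$, such that for every $T>0$ there is a constant $K$, depending only on $\beta,\delta,w,T$, for which the following holds for every $N\ge1$ and every chain as above: $d(t)\in\ell^1_w$ for all $t\ge0$; the moment vector $(m_n(t))_{n\ge1}$ is a solution of (M) in $\ell^1_w$ on $[0,T]$; and for every initial value $a\in\ell^1_w$ each of the systems (M) and (IE) has exactly one solution in $\ell^1_w$ on $[0,T]$ that starts at $a$, and these solutions $y$ and $f$ satisfy $$\|y(t)-f(t)\|_w\le\frac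 KN\qquad\text{for all } t\in[0,T].$$ In particular this holds with $y(t)=(m_n(t))_{n\ge1}$ and the solution $f$ of (IE) with $f(0)=(m_n(0))_{n\ge1}$. -/

import Mathlib

open Polynomial Filter Topology

namespace MomentSystem

noncomputable section

/-- Birth rate `β_k = N β(k/N)` (or death rate `δ_k = N δ(k/N)`) of the density dependent chain
with population size `N`. -/
def rate (b : ℝ[X]) (N k : ℕ) : ℝ := N * b.eval ((k : ℝ) / N)

/-- Right-hand side of the Kolmogorov equations at state `k ≤ N`:
`β_{k-1} p_{k-1} - (β_k + δ_k) p_k + δ_{k+1} p_{k+1}`, where the terms with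
index `-1` or `N + 1` are absent. -/
def kolmogorovRHS (β δ : ℝ[X]) (N : ℕ) (p : ℕ → ℝ) (k : ℕ) : ℝ :=
  (if k = 0 then 0 else rate β N (k - 1) * p (k - 1))
    - (rate β N k + rate δ N k) * p k
    + (if k < N then rate δ N (k + 1) * p (k + 1) else 0)

/-- `p t k` (`0 ≤ k ≤ N`, `t ≥ 0`) is the law of the chain on `{0, …, N}`: it starts from a
probability vector and solves the Kolmogorov equations. -/
structure IsChainLaw (β δ : ℝ[X]) (N : ℕ) (p : ℝ → ℕ → ℝ) : Prop where
  init_nonneg : ∀ k ≤ N, 0 ≤ p 0 k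
  init_sum : ∑ k ∈ Finset.range (N + 1), p 0 k = 1
  kolmogorov : ∀ k ≤ N, ∀ t : ℝ, 0 ≤ t →
    HasDerivWithinAt (fun s => p s k) (kolmogorovRHS β δ N (p t) k) (Set.Ici 0) t

/-- The moments `∑_{k=0}^N (k/N)^n p_k`. The moment of order `0` is the total mass. -/
def moment (N : ℕ) (p : ℕ → ℝ) (n : ℕ) : ℝ :=
  ∑ k ∈ Finset.range (N + 1), ((k : ℝ) / N) ^ n * p k

/-- `R_{k,n} = ((k+1)^n - k^n - n k^{n-1}) / N^{n-1}`, used for `n ≥ 1`. -/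
def remR (N k n : ℕ) : ℝ :=
  (((k : ℝ) + 1) ^ n - (k : ℝ) ^ n - n * (k : ℝ) ^ (n - 1)) / (N : ℝ) ^ (n - 1)

/-- `Q_{k,n} = ((k-1)^n - k^n + n k^{n-1}) / N^{n-1}`, used for `n ≥ 1`. -/
def remQ (N k n : ℕ) : ℝ :=
  (((k : ℝ) - 1) ^ n - (k : ℝ) ^ n + n * (k : ℝ) ^ (n - 1)) / (N : ℝ) ^ (n - 1)

/-- `d_n = ∑_{k=0}^N (β_k R_{k,n} + δ_k Q_{k,n}) p_k`. -/
def dTerm (β δ : ℝ[X]) (N : ℕ) (p : ℕ → ℝ) (n : ℕ) : ℝ :=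
  ∑ k ∈ Finset.range (N + 1), (rate β N k * remR N k n + rate δ N k * remQ N k n) * p k

/-- The formal operator `(𝓛 f)_n = n ∑_j q_j f_{n+j-1}`, used for `n ≥ 1`, where `q_j` are the
coefficients of the polynomial `q`. -/
def formalL (q : ℝ[X]) (f : ℕ → ℝ) (n : ℕ) : ℝ :=
  n * ∑ j ∈ Finset.range (q.natDegree + 1), q.coeff j * f (n + j - 1)

/-- Membership of `(x_n)_{n ≥ 1}` in the weighted space `ℓ¹_w`; the entry `x 0` plays no role. -/
def MemL1 (w x : ℕ → ℝ) : Prop := Summable fun n : ℕ => w (n + 1) * |x (n + 1)|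

/-- The norm `‖x‖_w = ∑_{n ≥ 1} w_n |x_n|` of `ℓ¹_w`. -/
def normL1 (w x : ℕ → ℝ) : ℝ := ∑' n : ℕ, w (n + 1) * |x (n + 1)|

/-- `f` is a solution on `[0, T]`, in `ℓ¹_w`, of the infinite system
`(d/dt) f_n = n ∑_j q_j f_{n+j-1} + s_n(t)`, `n ≥ 1`, with `f(0) = a` and `f_0 ≡ 1`
(the moment of order `0`, which occurs in the equation for `n = 1`): it is continuous with values
in `ℓ¹_w`, and every coordinate satisfies its equation. -/
structure IsSolution (q : ℝ[X]) (s : ℝ → ℕ → ℝ) (w : ℕ → ℝ) (T : ℝ) (a : ℕ → ℝ)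
    (f : ℝ → ℕ → ℝ) : Prop where
  init : f 0 = a
  zeroth : ∀ t ∈ Set.Icc 0 T, f t 0 = 1
  mem : ∀ t ∈ Set.Icc 0 T, MemL1 w (f t)
  cont : ∀ t ∈ Set.Icc 0 T,
    Tendsto (fun r => normL1 w (fun n => f r n - f t n)) (𝓝[Set.Icc 0 T] t) (𝓝 0)
  ode : ∀ n : ℕ, 1 ≤ n → ∀ t ∈ Set.Icc 0 T,
    HasDerivWithinAt (fun r => f r n) (formalL q (f t) n + s t n) (Set.Icc 0 T) t

/-- `f` is a solution on `[0, T]`, and every solution coincides with it on `[0, T]`. -/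
def IsUniqueSolution (q : ℝ[X]) (s : ℝ → ℕ → ℝ) (w : ℕ → ℝ) (T : ℝ) (a : ℕ → ℝ)
    (f : ℝ → ℕ → ℝ) : Prop :=
  IsSolution q s w T a f ∧
    ∀ f' : ℝ → ℕ → ℝ, IsSolution q s w T a f' → ∀ t ∈ Set.Icc 0 T, f' t = f t

end

end MomentSystem

open MomentSystem

/-!
The weights are `w_n = (n + 1)^{-4}`, and the argument moves between the spaces with weights
`(n + 1)^{-b}` for different exponents `b`. Sequences are indexed from `0`: row `0` of the operator
vanishes, so that the constant entry `f_0 = 1` becomes part of a homogeneous linear system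
`u' = A u`.

Off the diagonal the entries of `A` are nonnegative. They grow linearly in `n`, but the sum of the
coefficients `q_j` is nonpositive and `n (n + 1)^{-b}` varies slowly, so the weighted column sums of
`A` are at most a multiple of the weight (`sum_wt_mul_le`). A Gronwall argument for weighted sums of
absolute values (`sum_abs_le_gronwallBound`), applied to the first `M` rows, then gives an estimate
for `u' = A u + s` with a boundary term that involves the entries of `u` just beyond `M`. If `u` is
bounded with exponent `b`, this term is of order `1 / M` with exponent `b + 2`, which yields the a
priori estimate `normLE_of_formalL`.

* Uniqueness with exponent `4` is the a priori estimate with exponent `6`.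
* Existence (`exists_solution`) follows by truncation: the truncated systems have uniformly bounded
  solutions, and these form a Cauchy sequence when the initial value is truncated much earlier than
  the system.
* The law of the chain has `ℓ¹` norm at most `1`, by the same Gronwall argument, so the moments are
  bounded by `1` and have finite norm already with exponent `2`. The same is true of the solution
  `g` of the limit system that starts from the initial moments. Since `d_n` is of order `n ^ 2`
  (`abs_dTerm_le`), the a priori estimate with exponent `4` bounds the difference of the moments and
  `g` by a multiple of `1 / N`. By linearity `y - f` equals this difference for every initial value.
-/

/-! ### A Gronwall inequality for weighted sums of absolute values -/

/-- If `u' = c u + s` with `|s| ≤ R` from the right at `t`, then `|u|` has a right derivative at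
`t`, and it is at most `c |u| + R`. The bound keeps the sign of `c`, which is what makes a negative
diagonal useful. -/
theorem exists_hasDerivWithinAt_abs_le {u : ℝ → ℝ} {u' c R t : ℝ}
    (hu : HasDerivWithinAt u u' (Set.Ioi t) t) (hR : |u' - c * u t| ≤ R) :
    ∃ D ≤ c * |u t| + R, HasDerivWithinAt (fun r => |u r|) D (Set.Ioi t) t := by
  obtain ⟨h1, h2⟩ := abs_le.1 hR
  rcases lt_trichotomy (u t) 0 with h | h | h
  · refine ⟨-1 * u', ?_, (hasDerivAt_abs_neg h).comp_hasDerivWithinAt t hu⟩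
    rw [abs_of_neg h]
    linarith
  · refine ⟨|u'|, by simpa [h] using hR, ?_⟩
    rw [hasDerivWithinAt_iff_tendsto_slope' (by simp)] at hu ⊢
    refine hu.abs.congr' ?_
    filter_upwards [self_mem_nhdsWithin] with z hz
    have hz' : 0 < z - t := sub_pos.2 hz
    simp only [slope_def_field, h, abs_zero, sub_zero, abs_div, abs_of_pos hz']
  · refine ⟨1 * u', ?_, (hasDerivAt_abs_pos h).comp_hasDerivWithinAt t hu⟩
    rw [abs_of_pos h]
    linarith

/-- A Gronwall inequality for a finite weighted sum of absolute values, in which the diagonal terms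
`c n * u n` of the system enter with their sign. -/
theorem sum_abs_le_gronwallBound (S : Finset ℕ) {v : ℕ → ℝ} (hv : ∀ n, 0 ≤ v n)
    {u u' R : ℝ → ℕ → ℝ} {c : ℕ → ℝ} {T ω ε A : ℝ}
    (hu : ∀ n ∈ S, ∀ t ∈ Set.Icc 0 T, HasDerivWithinAt (fun r => u r n) (u' t n) (Set.Icc 0 T) t)
    (hR : ∀ n ∈ S, ∀ t ∈ Set.Icc 0 T, |u' t n - c n * u t n| ≤ R t n)
    (h0 : ∑ n ∈ S, v n * |u 0 n| ≤ A)
    (hb : ∀ t ∈ Set.Icc 0 T,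
      ∑ n ∈ S, v n * (c n * |u t n| + R t n) ≤ ω * ∑ n ∈ S, v n * |u t n| + ε) :
    ∀ t ∈ Set.Icc 0 T, ∑ n ∈ S, v n * |u t n| ≤ gronwallBound A ω ε t := by
  have key : ∀ t ∈ Set.Ico 0 T, ∃ D ≤ ω * ∑ n ∈ S, v n * |u t n| + ε,
      HasDerivWithinAt (fun r => ∑ n ∈ S, v n * |u r n|) D (Set.Ioi t) t := by
    intro t ht
    have ht' := Set.Ico_subset_Icc_self ht
    have h1 : ∀ n, ∃ D, n ∈ S → (D ≤ c n * |u t n| + R t n ∧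
        HasDerivWithinAt (fun r => |u r n|) D (Set.Ioi t) t) := by
      intro n
      by_cases hn : n ∈ S
      · have h2 : HasDerivWithinAt (fun r => u r n) (u' t n) (Set.Ioi t) t :=
          (hu n hn t ht').mono_of_mem_nhdsWithin
            (mem_of_superset (Ioc_mem_nhdsGT ht.2) fun z hz => ⟨ht.1.trans hz.1.le, hz.2⟩)
        obtain ⟨D, hD, h3⟩ := exists_hasDerivWithinAt_abs_le h2 (hR n hn t ht')
        exact ⟨D, fun _ => ⟨hD, h3⟩⟩
      · exact ⟨0, fun h => absurd h hn⟩
    choose D hD using h1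
    refine ⟨∑ n ∈ S, v n * D n, le_trans ?_ (hb t ht'),
      HasDerivWithinAt.fun_sum fun n hn => (hD n hn).2.const_mul (v n)⟩
    exact Finset.sum_le_sum fun n hn => mul_le_mul_of_nonneg_left (hD n hn).1 (hv n)
  have key' : ∀ t, ∃ D, t ∈ Set.Ico 0 T → (D ≤ ω * ∑ n ∈ S, v n * |u t n| + ε ∧
      HasDerivWithinAt (fun r => ∑ n ∈ S, v n * |u r n|) D (Set.Ioi t) t) := by
    intro t
    by_cases ht : t ∈ Set.Ico 0 T
    · obtain ⟨D, h⟩ := key t ht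
      exact ⟨D, fun _ => h⟩
    · exact ⟨0, fun h => absurd h ht⟩
  choose D hD using key'
  intro t ht
  have hcont : ContinuousOn (fun r => ∑ n ∈ S, v n * |u r n|) (Set.Icc 0 T) :=
    continuousOn_finsetSum _ fun n hn => continuousOn_const.mul
      (ContinuousOn.abs fun t ht => (hu n hn t ht).continuousWithinAt)
  have := le_gronwallBound_of_liminf_deriv_right_le (f' := D) hcont
    (fun x hx r hr => ?_) h0 (fun x hx => (hD x hx).1) t ht
  · simpa using this
  · have h := (hasDerivWithinAt_iff_tendsto_slope' (by simp)).1 (hD x hx).2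
    refine ((h.eventually_lt_const hr).mono fun z hz => ?_).frequently
    rwa [slope_def_field, div_eq_inv_mul] at hz

theorem gronwallBound_le_mul_exp {A ε ω t T : ℝ} (hA : 0 ≤ A) (hε : 0 ≤ ε) (hω : 1 ≤ ω)
    (ht : t ∈ Set.Icc 0 T) : gronwallBound A ω ε t ≤ (A + ε) * Real.exp (ω * T) := by
  rw [gronwallBound_of_K_ne_0 (by linarith)]
  have h1 : Real.exp (ω * t) ≤ Real.exp (ω * T) :=
    Real.exp_le_exp.2 (mul_le_mul_of_nonneg_left ht.2 (by linarith))
  have h2 : 1 ≤ Real.exp (ω * t) := Real.one_le_exp (mul_nonneg (by linarith) ht.1)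
  have h3 : ε / ω ≤ ε := div_le_self hε hω
  have h4 : ε / ω * (Real.exp (ω * t) - 1) ≤ ε * Real.exp (ω * T) :=
    mul_le_mul h3 (by linarith) (by linarith) hε
  have h5 := mul_le_mul_of_nonneg_left h1 hA
  show A * Real.exp (ω * t) + ε / ω * (Real.exp (ω * t) - 1) ≤ _
  linarith

/-! ### Polynomial weights and the column sums of the system -/

/-- The weight `(n + 1)^{-b}`. -/
noncomputable def wt (b n : ℕ) : ℝ := (((n : ℝ) + 1) ^ b)⁻¹

theorem wt_pos (b n : ℕ) : 0 < wt b n := by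
  unfold wt
  positivity

/-- The constant in the comparison of `n * wt b n` with its shifts by at most `D`. -/
noncomputable def shiftConst (b D : ℕ) : ℝ := 1 + b * D * ((D : ℝ) + 1) ^ b

theorem one_le_shiftConst (b D : ℕ) : 1 ≤ shiftConst b D := by
  unfold shiftConst
  have : (0 : ℝ) ≤ b * D * ((D : ℝ) + 1) ^ b := by positivity
  linarith

theorem mul_pow_sub_pow_le {y i : ℝ} (hy : 0 ≤ y) (hi : 0 ≤ i) (b : ℕ) :
    y * ((y + i) ^ b - y ^ b) ≤ b * i * (y + i) ^ b := by
  induction b with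
  | zero => simp
  | succ b ih =>
    have h1 : y * y ^ b ≤ (y + i) * (y + i) ^ b := by
      gcongr <;> linarith
    have h2 := mul_le_mul_of_nonneg_left ih (add_nonneg hy hi)
    have h3 := mul_le_mul_of_nonneg_left h1 hi
    push_cast
    rw [pow_succ, pow_succ]
    nlinarith

/-- The function `n * (n + 1)^{-b}` decreases by at most a multiple of the weight under a shift.
This is why weights of power type make the column sums of the system at most a multiple of the
weight: the linear growth of the rates costs one power of `n`, which the difference regains. -/
theorem mul_wt_le_shift (b n : ℕ) {i D : ℕ} (hi : i ≤ D) :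
    n * wt b n ≤ ((n + i : ℕ) + shiftConst b D) * wt b (n + i) := by
  unfold wt
  set y : ℝ := (n : ℝ) + 1 with hy
  have hy1 : 1 ≤ y := by rw [hy]; linarith [(Nat.cast_nonneg n : (0 : ℝ) ≤ n)]
  have hiD : (i : ℝ) ≤ D := by exact_mod_cast hi
  have hi0 : (0 : ℝ) ≤ i := Nat.cast_nonneg i
  have e : ((n + i : ℕ) : ℝ) + 1 = y + i := by push_cast; ring
  rw [e, ← div_eq_mul_inv, ← div_eq_mul_inv, div_le_div_iff₀ (by positivity) (by positivity)]
  have h1 : y * ((y + i) ^ b - y ^ b) ≤ b * i * (y + i) ^ b :=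
    mul_pow_sub_pow_le (by linarith) hi0 b
  have h2 : (y + i) ^ b ≤ (((D : ℝ) + 1) * y) ^ b := by
    gcongr
    nlinarith
  rw [mul_pow] at h2
  have h3 : (b : ℝ) * i * (y + i) ^ b ≤ b * D * (((D : ℝ) + 1) ^ b * y ^ b) := by
    gcongr
  have h4 : y ^ b ≤ (y + i) ^ b := by gcongr; linarith
  have h5 : 0 ≤ y ^ b := by positivity
  have h6 := mul_nonneg hi0 h5
  have hn : (n : ℝ) = y - 1 := by rw [hy]; ring
  unfold shiftConst
  push_cast
  rw [hn]
  nlinarith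

theorem succ_mul_wt_succ_le (b n D : ℕ) :
    (n + 1 : ℕ) * wt b (n + 1) ≤ (n + shiftConst b D) * wt b n := by
  have h1 : wt b (n + 1) ≤ wt b n := by
    unfold wt
    gcongr
    linarith
  have h2 := one_le_shiftConst b D
  push_cast
  exact mul_le_mul (by linarith) h1 (wt_pos _ _).le (by positivity)

/-- The weighted column sums of the system, in dual form: for `x ≥ 0` the weighted sum of the first
`M` rows is at most a multiple of the weighted sum of `x`, up to the entries of `x` beyond `M`
that those rows reach. -/
theorem sum_wt_mul_le (b M D : ℕ) {q₀ q₁ : ℝ} {r x : ℕ → ℝ} (hq₀ : 0 ≤ q₀)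
    (hr : ∀ i, 0 ≤ r i) (hsum : q₀ + q₁ + ∑ i ∈ Finset.range D, r i ≤ 0) (hx : ∀ n, 0 ≤ x n) :
    ∑ n ∈ Finset.range M, wt b n * (n * q₁ * x n +
        n * (q₀ * x (n - 1) + ∑ i ∈ Finset.range D, r i * x (n + i + 1))) ≤
      shiftConst b D * (q₀ + ∑ i ∈ Finset.range D, r i) * (∑ n ∈ Finset.range M, wt b n * x n) +
        (∑ i ∈ Finset.range D, r i) *
          ∑ m ∈ Finset.Ico M (M + D), (m + shiftConst b D) * wt b m * x m := by
  set C := shiftConst b D with hC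
  have hC1 : 1 ≤ C := one_le_shiftConst b D
  set h : ℕ → ℝ := fun m => (m + C) * wt b m * x m with hh
  have hh0 : ∀ m, 0 ≤ h m := fun m =>
    mul_nonneg (mul_nonneg (by positivity) (wt_pos b m).le) (hx m)
  have hup : ∑ n ∈ Finset.range M, n * wt b n * x (n - 1) ≤ ∑ m ∈ Finset.range M, h m := by
    cases M with
    | zero => simp
    | succ M =>
      rw [Finset.sum_range_succ', Finset.sum_range_succ]
      have : ∑ k ∈ Finset.range M, ((k + 1 : ℕ) : ℝ) * wt b (k + 1) * x (k + 1 - 1) ≤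
          ∑ k ∈ Finset.range M, h k :=
        Finset.sum_le_sum fun k _ =>
          mul_le_mul_of_nonneg_right (succ_mul_wt_succ_le b k D) (hx k)
      simpa using add_le_add this (hh0 M)
  have hdown : ∀ i ∈ Finset.range D, ∑ n ∈ Finset.range M, n * wt b n * x (n + i + 1) ≤
      ∑ m ∈ Finset.range M, h m + ∑ m ∈ Finset.Ico M (M + D), h m := by
    intro i hi
    have hi' : i + 1 ≤ D := Finset.mem_range.1 hi
    rw [Finset.sum_range_add_sum_Ico _ (Nat.le_add_right M D)]
    calc ∑ n ∈ Finset.range M, n * wt b n * x (n + i + 1)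
        ≤ ∑ n ∈ Finset.range M, h (n + (i + 1)) :=
          Finset.sum_le_sum fun n _ =>
            mul_le_mul_of_nonneg_right (mul_wt_le_shift b n hi') (hx _)
      _ = ∑ m ∈ Finset.Ico (0 + (i + 1)) (M + (i + 1)), h m := by
          rw [Finset.range_eq_Ico, Finset.sum_Ico_add' h 0 M (i + 1)]
      _ ≤ ∑ m ∈ Finset.range (M + D), h m := by
          refine Finset.sum_le_sum_of_subset_of_nonneg (fun m hm => ?_) fun m _ _ => hh0 m
          simp only [Finset.mem_Ico, Finset.mem_range] at hm ⊢
          omega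
  have e : ∑ n ∈ Finset.range M, wt b n * (n * q₁ * x n +
        n * (q₀ * x (n - 1) + ∑ i ∈ Finset.range D, r i * x (n + i + 1))) =
      q₁ * (∑ n ∈ Finset.range M, n * wt b n * x n) +
      q₀ * (∑ n ∈ Finset.range M, n * wt b n * x (n - 1)) +
      ∑ i ∈ Finset.range D, r i * ∑ n ∈ Finset.range M, n * wt b n * x (n + i + 1) := by
    simp only [Finset.mul_sum]
    rw [Finset.sum_comm, ← Finset.sum_add_distrib, ← Finset.sum_add_distrib]
    refine Finset.sum_congr rfl fun n _ => ?_
    rw [mul_add, mul_add, mul_add, Finset.mul_sum, Finset.mul_sum, add_assoc]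
    congr 1
    · ring
    congr 1
    · ring
    · exact Finset.sum_congr rfl fun i _ => by ring
  have hlast := Finset.sum_le_sum fun i hi => mul_le_mul_of_nonneg_left (hdown i hi) (hr i)
  rw [← Finset.sum_mul] at hlast
  have hG : ∑ m ∈ Finset.range M, h m =
      ∑ n ∈ Finset.range M, n * wt b n * x n + C * ∑ n ∈ Finset.range M, wt b n * x n := by
    rw [Finset.mul_sum, ← Finset.sum_add_distrib]
    exact Finset.sum_congr rfl fun n _ => by simp only [hh]; ring
  have hG0 : 0 ≤ ∑ n ∈ Finset.range M, n * wt b n * x n :=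
    Finset.sum_nonneg fun n _ => mul_nonneg (mul_nonneg (by positivity) (wt_pos b n).le) (hx n)
  have h1 := mul_le_mul_of_nonneg_left hup hq₀
  have h2 := mul_nonneg (neg_nonneg.2 hsum) hG0
  rw [e]
  change _ ≤ _ + _ * ∑ m ∈ Finset.Ico M (M + D), h m
  rw [hG] at h1 hlast
  linarith

/-! ### The formal operator -/

theorem formalL_zero (q : ℝ[X]) (f : ℕ → ℝ) : formalL q f 0 = 0 := by
  simp [formalL]

theorem formalL_add (q : ℝ[X]) (f g : ℕ → ℝ) (n : ℕ) :
    formalL q (fun m => f m + g m) n = formalL q f n + formalL q g n := by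
  simp only [formalL, mul_add, Finset.sum_add_distrib]

theorem formalL_sub (q : ℝ[X]) (f g : ℕ → ℝ) (n : ℕ) :
    formalL q (fun m => f m - g m) n = formalL q f n - formalL q g n := by
  simp only [formalL, mul_sub, Finset.sum_sub_distrib]

theorem formalL_const_mul (q : ℝ[X]) (c : ℝ) (f : ℕ → ℝ) (n : ℕ) :
    formalL q (fun m => c * f m) n = c * formalL q f n := by
  simp only [formalL, Finset.mul_sum]
  exact Finset.sum_congr rfl fun j _ => by ring

theorem sum_range_natDegree_add_two (q : ℝ[X]) (g : ℕ → ℝ) :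
    ∑ j ∈ Finset.range (q.natDegree + 1), q.coeff j * g j =
      ∑ i ∈ Finset.range q.natDegree, q.coeff (i + 2) * g (i + 2) + q.coeff 1 * g 1 +
        q.coeff 0 * g 0 := by
  have h := Finset.sum_range_succ (fun j => q.coeff j * g j) (q.natDegree + 1)
  rw [Polynomial.coeff_eq_zero_of_natDegree_lt (Nat.lt_succ_self _), zero_mul, add_zero] at h
  rw [← h, Finset.sum_range_succ', Finset.sum_range_succ']

theorem formalL_eq (q : ℝ[X]) (f : ℕ → ℝ) (n : ℕ) :
    formalL q f n = n * (q.coeff 0 * f (n - 1) + q.coeff 1 * f n +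
      ∑ i ∈ Finset.range q.natDegree, q.coeff (i + 2) * f (n + i + 1)) := by
  rw [formalL, sum_range_natDegree_add_two q fun j => f (n + j - 1)]
  simp only [add_zero, Nat.add_sub_cancel]
  have : ∀ i, n + (i + 2) - 1 = n + i + 1 := fun i => by omega
  simp only [this]
  ring

/-- The sign conditions on `q = β - δ` that make the system quasi-dissipative: the off-diagonal
coefficients are nonnegative and `q(1) ≤ 0`. -/
structure SignCond (q : ℝ[X]) : Prop where
  coeff_nonneg : ∀ j : ℕ, j ≠ 1 → 0 ≤ q.coeff j
  sum_nonpos : ∑ j ∈ Finset.range (q.natDegree + 1), q.coeff j ≤ 0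

/-- The sum of the coefficients of degree at least `2`. -/
noncomputable def highSum (q : ℝ[X]) : ℝ := ∑ i ∈ Finset.range q.natDegree, q.coeff (i + 2)

/-- A bound for the growth rate of the system in the norm with weights `(n + 1)^{-b}`. -/
noncomputable def growthRate (q : ℝ[X]) (b : ℕ) : ℝ :=
  1 + shiftConst b q.natDegree * (q.coeff 0 + highSum q)

theorem SignCond.highSum_nonneg {q : ℝ[X]} (hq : SignCond q) : 0 ≤ highSum q :=
  Finset.sum_nonneg fun i _ => hq.coeff_nonneg (i + 2) (by omega)

theorem SignCond.coeff_zero_nonneg {q : ℝ[X]} (hq : SignCond q) : 0 ≤ q.coeff 0 :=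
  hq.coeff_nonneg 0 (by omega)

theorem SignCond.one_le_growthRate {q : ℝ[X]} (hq : SignCond q) (b : ℕ) : 1 ≤ growthRate q b := by
  have h1 := one_le_shiftConst b q.natDegree
  have := mul_nonneg (by linarith : 0 ≤ shiftConst b q.natDegree)
    (add_nonneg hq.coeff_zero_nonneg hq.highSum_nonneg)
  unfold growthRate
  linarith

theorem abs_formalL_sub_le {q : ℝ[X]} (hq : SignCond q) (f : ℕ → ℝ) (n : ℕ) :
    |formalL q f n - n * q.coeff 1 * f n| ≤ n * (q.coeff 0 * |f (n - 1)| +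
      ∑ i ∈ Finset.range q.natDegree, q.coeff (i + 2) * |f (n + i + 1)|) := by
  have e : formalL q f n - n * q.coeff 1 * f n = n * (q.coeff 0 * f (n - 1) +
      ∑ i ∈ Finset.range q.natDegree, q.coeff (i + 2) * f (n + i + 1)) := by
    rw [formalL_eq]
    ring
  rw [e, abs_mul, Nat.abs_cast]
  refine mul_le_mul_of_nonneg_left ((abs_add_le _ _).trans (add_le_add ?_ ?_)) (Nat.cast_nonneg n)
  · rw [abs_mul, abs_of_nonneg hq.coeff_zero_nonneg]
  · refine (Finset.abs_sum_le_sum_abs _ _).trans (Finset.sum_le_sum fun i _ => ?_)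
    rw [abs_mul, abs_of_nonneg (hq.coeff_nonneg (i + 2) (by omega))]

/-! ### A priori estimates -/

/-- A priori bound for the first `M` rows of the system. The entries beyond `M` that these rows
reach are treated as part of the inhomogeneity. -/
theorem sum_range_wt_le {q : ℝ[X]} (hq : SignCond q) (b M : ℕ) {u s : ℝ → ℕ → ℝ} {T A ε : ℝ}
    (hu : ∀ n < M, ∀ t ∈ Set.Icc 0 T,
      HasDerivWithinAt (fun r => u r n) (formalL q (u t) n + s t n) (Set.Icc 0 T) t)
    (hA : ∑ n ∈ Finset.range M, wt b n * |u 0 n| ≤ A)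
    (hε : ∀ t ∈ Set.Icc 0 T, ∑ n ∈ Finset.range M, wt b n * |s t n| +
      highSum q * ∑ m ∈ Finset.Ico M (M + q.natDegree),
        (m + shiftConst b q.natDegree) * wt b m * |u t m| ≤ ε) :
    ∀ t ∈ Set.Icc 0 T, ∑ n ∈ Finset.range M, wt b n * |u t n| ≤
      (A + ε) * Real.exp (growthRate q b * T) := by
  intro t ht
  have hC := one_le_shiftConst b q.natDegree
  have hA0 : 0 ≤ A :=
    (Finset.sum_nonneg fun n _ => mul_nonneg (wt_pos b n).le (abs_nonneg _)).trans hA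
  have hε0 : 0 ≤ ε := by
    refine le_trans (add_nonneg ?_ (mul_nonneg hq.highSum_nonneg ?_)) (hε t ht)
    · exact Finset.sum_nonneg fun n _ => mul_nonneg (wt_pos b n).le (abs_nonneg _)
    · exact Finset.sum_nonneg fun n _ => mul_nonneg (mul_nonneg
        (add_nonneg (Nat.cast_nonneg n) (by linarith)) (wt_pos b n).le) (abs_nonneg _)
  refine (sum_abs_le_gronwallBound (Finset.range M) (fun n => (wt_pos b n).le)
    (u' := fun t n => formalL q (u t) n + s t n)
    (R := fun t n => n * (q.coeff 0 * |u t (n - 1)| +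
      ∑ i ∈ Finset.range q.natDegree, q.coeff (i + 2) * |u t (n + i + 1)|) + |s t n|)
    (c := fun n => n * q.coeff 1) (ω := growthRate q b) (ε := ε)
    (fun n hn => hu n (Finset.mem_range.1 hn)) ?_ hA ?_ t ht).trans
      (gronwallBound_le_mul_exp hA0 hε0 (hq.one_le_growthRate b) ht)
  · intro n _ t _
    have e : formalL q (u t) n + s t n - n * q.coeff 1 * u t n =
        (formalL q (u t) n - n * q.coeff 1 * u t n) + s t n := by ring
    rw [e]
    exact (abs_add_le _ _).trans (add_le_add_left (abs_formalL_sub_le hq _ _) _)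
  · intro t ht
    have h1 := sum_wt_mul_le b M q.natDegree (q₁ := q.coeff 1) (r := fun i => q.coeff (i + 2))
      hq.coeff_zero_nonneg (fun i => hq.coeff_nonneg (i + 2) (by omega)) (by
        have h := sum_range_natDegree_add_two q fun _ => 1
        have h' := hq.sum_nonpos
        simp only [mul_one] at h
        linarith) (fun n => abs_nonneg (u t n))
    have h2 := hε t ht
    have h3 : ∑ n ∈ Finset.range M, wt b n * (n * q.coeff 1 * |u t n| +
        (n * (q.coeff 0 * |u t (n - 1)| +
          ∑ i ∈ Finset.range q.natDegree, q.coeff (i + 2) * |u t (n + i + 1)|) + |s t n|)) =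
        ∑ n ∈ Finset.range M, wt b n * (n * q.coeff 1 * |u t n| +
          n * (q.coeff 0 * |u t (n - 1)| +
            ∑ i ∈ Finset.range q.natDegree, q.coeff (i + 2) * |u t (n + i + 1)|)) +
        ∑ n ∈ Finset.range M, wt b n * |s t n| := by
      rw [← Finset.sum_add_distrib]
      exact Finset.sum_congr rfl fun n _ => by ring
    have h4 : 0 ≤ ∑ n ∈ Finset.range M, wt b n * |u t n| :=
      Finset.sum_nonneg fun n _ => mul_nonneg (wt_pos b n).le (abs_nonneg _)
    rw [h3]
    unfold growthRate highSum
    unfold highSum at h2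
    linarith

/-- The weighted `ℓ¹` norm with weights `(n + 1)^{-b}` of the whole sequence, entry `0` included, is
at most `B`. It is stated through partial sums, so that it entails summability. -/
def NormLE (b : ℕ) (x : ℕ → ℝ) (B : ℝ) : Prop :=
  ∀ K : ℕ, ∑ n ∈ Finset.range K, wt b n * |x n| ≤ B

theorem NormLE.nonneg {b : ℕ} {x : ℕ → ℝ} {B : ℝ} (h : NormLE b x B) : 0 ≤ B := by
  simpa using h 0

theorem NormLE.mono {b : ℕ} {x : ℕ → ℝ} {B B' : ℝ} (h : NormLE b x B) (hB : B ≤ B') :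
    NormLE b x B' := fun K => (h K).trans hB

theorem NormLE.add {b : ℕ} {x y : ℕ → ℝ} {B B' : ℝ} (hx : NormLE b x B) (hy : NormLE b y B') :
    NormLE b (fun n => x n + y n) (B + B') := by
  intro K
  refine le_trans ?_ (add_le_add (hx K) (hy K))
  rw [← Finset.sum_add_distrib]
  refine Finset.sum_le_sum fun n _ => ?_
  rw [← mul_add]
  exact mul_le_mul_of_nonneg_left (abs_add_le _ _) (wt_pos b n).le

theorem NormLE.neg {b : ℕ} {x : ℕ → ℝ} {B : ℝ} (hx : NormLE b x B) :
    NormLE b (fun n => -x n) B := by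
  intro K
  simpa only [abs_neg] using hx K

theorem NormLE.sub {b : ℕ} {x y : ℕ → ℝ} {B B' : ℝ} (hx : NormLE b x B) (hy : NormLE b y B') :
    NormLE b (fun n => x n - y n) (B + B') := by
  simpa only [sub_eq_add_neg] using hx.add hy.neg

theorem NormLE.of_abs_le {b : ℕ} {x y : ℕ → ℝ} {B : ℝ} (h : NormLE b y B)
    (hxy : ∀ n, |x n| ≤ |y n|) : NormLE b x B := fun K =>
  (Finset.sum_le_sum fun n _ => mul_le_mul_of_nonneg_left (hxy n) (wt_pos b n).le).trans (h K)

theorem wt_anti {b b' : ℕ} (h : b ≤ b') (n : ℕ) : wt b' n ≤ wt b n := by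
  unfold wt
  have : (1 : ℝ) ≤ (n : ℝ) + 1 := by linarith [(Nat.cast_nonneg n : (0 : ℝ) ≤ n)]
  gcongr

theorem NormLE.weaken {b b' : ℕ} {x : ℕ → ℝ} {B : ℝ} (h : NormLE b x B) (hb : b ≤ b') :
    NormLE b' x B := fun K =>
  (Finset.sum_le_sum fun n _ => mul_le_mul_of_nonneg_right (wt_anti hb n) (abs_nonneg _)).trans
    (h K)

theorem NormLE.abs_apply_le {b : ℕ} {x : ℕ → ℝ} {B : ℝ} (h : NormLE b x B) (n : ℕ) :
    wt b n * |x n| ≤ B :=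
  (Finset.single_le_sum (f := fun n => wt b n * |x n|)
    (fun m _ => mul_nonneg (wt_pos b m).le (abs_nonneg _)) (Finset.self_mem_range_succ n)).trans
    (h (n + 1))

theorem wt_add_two (b n : ℕ) : wt (b + 2) n = wt b n / ((n : ℝ) + 1) ^ 2 := by
  unfold wt
  rw [pow_add, mul_inv, div_eq_mul_inv]

/-- The a priori estimate for the infinite system. It loses two powers of `n`: for a solution that
is bounded with exponent `b`, the boundary term of the first `M` rows with exponent `b + 2` is of
order `1 / M`. -/
theorem normLE_of_formalL {q : ℝ[X]} (hq : SignCond q) {b : ℕ} {u s : ℝ → ℕ → ℝ} {T A B σ : ℝ}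
    (hu : ∀ n, ∀ t ∈ Set.Icc 0 T,
      HasDerivWithinAt (fun r => u r n) (formalL q (u t) n + s t n) (Set.Icc 0 T) t)
    (hB : ∀ t ∈ Set.Icc 0 T, NormLE b (u t) B)
    (hA : NormLE (b + 2) (u 0) A)
    (hσ : ∀ t ∈ Set.Icc 0 T, NormLE (b + 2) (s t) σ) :
    ∀ t ∈ Set.Icc 0 T, NormLE (b + 2) (u t) ((A + σ) * Real.exp (growthRate q (b + 2) * T)) := by
  intro t ht K
  set C := shiftConst (b + 2) q.natDegree with hC
  have hC1 : 1 ≤ C := one_le_shiftConst _ _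
  have hB0 : 0 ≤ B := (hB t ht).nonneg
  have hM : ∀ M : ℕ, K ≤ M → ∑ n ∈ Finset.range K, wt (b + 2) n * |u t n| ≤
      (A + (σ + highSum q * ((1 + C) * B) * (1 / ((M : ℝ) + 1)))) *
        Real.exp (growthRate q (b + 2) * T) := by
    intro M hKM
    refine le_trans (Finset.sum_le_sum_of_subset_of_nonneg
      (Finset.range_subset_range.2 hKM) fun n _ _ => mul_nonneg (wt_pos _ n).le (abs_nonneg _)) ?_
    refine sum_range_wt_le hq (b + 2) M (fun n _ => hu n) (hA M) (fun t ht => ?_) t ht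
    refine add_le_add (hσ t ht M) ?_
    rw [mul_assoc]
    refine mul_le_mul_of_nonneg_left ?_ hq.highSum_nonneg
    calc ∑ m ∈ Finset.Ico M (M + q.natDegree), (m + C) * wt (b + 2) m * |u t m|
        ≤ ∑ m ∈ Finset.Ico M (M + q.natDegree), (1 + C) * (1 / ((M : ℝ) + 1)) *
            (wt b m * |u t m|) := by
          refine Finset.sum_le_sum fun m hm => ?_
          have hMm : (M : ℝ) ≤ m := by exact_mod_cast (Finset.mem_Ico.1 hm).1
          have hm0 : (0 : ℝ) < (m : ℝ) + 1 := by positivity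
          rw [wt_add_two]
          have h1 : (m + C) / ((m : ℝ) + 1) ^ 2 ≤ (1 + C) * (1 / ((M : ℝ) + 1)) := by
            calc (m + C) / ((m : ℝ) + 1) ^ 2
                ≤ ((1 + C) * ((m : ℝ) + 1)) / ((m : ℝ) + 1) ^ 2 := by
                  gcongr
                  nlinarith [(Nat.cast_nonneg m : (0 : ℝ) ≤ m)]
              _ = (1 + C) * (1 / ((m : ℝ) + 1)) := by field_simp
              _ ≤ _ := by gcongr
          calc (m + C) * (wt b m / ((m : ℝ) + 1) ^ 2) * |u t m|
              = (m + C) / ((m : ℝ) + 1) ^ 2 * (wt b m * |u t m|) := by ring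
            _ ≤ _ := mul_le_mul_of_nonneg_right h1
                (mul_nonneg (wt_pos b m).le (abs_nonneg _))
      _ ≤ (1 + C) * (1 / ((M : ℝ) + 1)) * B := by
          rw [← Finset.mul_sum]
          refine mul_le_mul_of_nonneg_left (le_trans ?_ (hB t ht (M + q.natDegree)))
            (by positivity)
          refine Finset.sum_le_sum_of_subset_of_nonneg (fun m hm => ?_) fun m _ _ =>
            mul_nonneg (wt_pos _ m).le (abs_nonneg _)
          exact Finset.mem_range.2 (Finset.mem_Ico.1 hm).2
      _ = (1 + C) * B * (1 / ((M : ℝ) + 1)) := by ring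
  have hlim : Tendsto (fun M : ℕ => (A + (σ + highSum q * ((1 + C) * B) * (1 / ((M : ℝ) + 1)))) *
      Real.exp (growthRate q (b + 2) * T)) atTop
      (𝓝 ((A + (σ + highSum q * ((1 + C) * B) * 0)) * Real.exp (growthRate q (b + 2) * T))) :=
    (((tendsto_one_div_add_atTop_nhds_zero_nat.const_mul _).const_add _).const_add _).mul_const _
  rw [mul_zero, add_zero] at hlim
  exact ge_of_tendsto hlim ((eventually_ge_atTop K).mono hM)

/-! ### Existence of solutions -/

/-- The solution of the system truncated to the first `M` entries. Seen as a sequence it solves the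
infinite system, except that the equation in row `M` lacks its only contribution from below. -/
theorem exists_truncated_solution (q : ℝ[X]) {M : ℕ} (hM : 0 < M) {a : ℕ → ℝ}
    (ha : ∀ n, M ≤ n → a n = 0) :
    ∃ u : ℝ → ℕ → ℝ, u 0 = a ∧ (∀ t n, M ≤ n → u t n = 0) ∧
      ∀ t n, HasDerivAt (fun r => u r n)
        (formalL q (u t) n - if n = M then M * (q.coeff 0 * u t (M - 1)) else 0) t := by
  set ext : (Fin M → ℝ) → ℕ → ℝ := fun x n => if h : n < M then x ⟨n, h⟩ else 0 with hext
  have ext_add : ∀ x y, ext (x + y) = fun n => ext x n + ext y n := by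
    intro x y
    funext n
    by_cases h : n < M <;> simp [hext, h]
  have ext_smul : ∀ (c : ℝ) x, ext (c • x) = fun n => c * ext x n := by
    intro c x
    funext n
    by_cases h : n < M <;> simp [hext, h]
  let A : (Fin M → ℝ) →ₗ[ℝ] (Fin M → ℝ) :=
    { toFun := fun x i => formalL q (ext x) i
      map_add' := fun x y => by
        funext i
        rw [ext_add, formalL_add]
        rfl
      map_smul' := fun c x => by
        funext i
        rw [ext_smul, formalL_const_mul]
        rfl }
  let B : (Fin M → ℝ) →L[ℝ] (Fin M → ℝ) := LinearMap.toContinuousLinearMap A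
  let x₀ : Fin M → ℝ := fun i => a i
  let v : ℝ → Fin M → ℝ := fun t => NormedSpace.exp (t • B) x₀
  have hv : ∀ t, HasDerivAt v (A (v t)) t := by
    intro t
    have h := (hasDerivAt_exp_smul_const' B t).clm_apply (hasDerivAt_const t x₀)
    simpa [v, B] using h
  refine ⟨fun t => ext (v t), ?_, fun t n hn => by simp [hext, hn], fun t n => ?_⟩
  · funext n
    by_cases h : n < M
    · simp [hext, h, v, x₀]
    · simp [hext, h, ha n (not_lt.1 h)]
  · by_cases h : n < M
    · have h1 := hasDerivAt_pi.1 (hv t) ⟨n, h⟩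
      have h2 : (fun r => ext (v r) n) = fun r => v r ⟨n, h⟩ := by
        funext r
        simp [hext, h]
      rw [h2, if_neg h.ne, sub_zero]
      exact h1
    · have h2 : (fun r => ext (v r) n) = fun _ => 0 := by
        funext r
        simp [hext, h]
      have h3 : formalL q (ext (v t)) n -
          (if n = M then (M : ℝ) * (q.coeff 0 * ext (v t) (M - 1)) else 0) = 0 := by
        have hz : ∀ m, M ≤ m → ext (v t) m = 0 := fun m hm => by simp [hext, hm]
        have hs : ∑ i ∈ Finset.range q.natDegree, q.coeff (i + 2) * ext (v t) (n + i + 1) = 0 :=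
          Finset.sum_eq_zero fun i _ => by rw [hz _ (by omega), mul_zero]
        rw [formalL_eq, hs, hz n (by omega)]
        by_cases hnM : n = M
        · subst hnM
          simp
        · rw [if_neg hnM, hz (n - 1) (by omega)]
          simp
      rw [h2, h3]
      exact hasDerivAt_const t 0

/-- Termwise differentiation on a convex set, with one-sided derivatives at its boundary: if `F k`
converges to `f` pointwise and the derivatives converge uniformly to `f'`, then `f' = df/dt`. -/
theorem hasDerivWithinAt_of_uniform_limit {s : Set ℝ} (hs : Convex ℝ s) {F F' : ℕ → ℝ → ℝ}
    {f f' : ℝ → ℝ} (hF : ∀ k, ∀ t ∈ s, HasDerivWithinAt (F k) (F' k t) s t)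
    (hlim : ∀ t ∈ s, Tendsto (fun k => F k t) atTop (𝓝 (f t)))
    (hlim' : TendstoUniformlyOn F' f' atTop s) {t : ℝ} (ht : t ∈ s) :
    HasDerivWithinAt f (f' t) s t := by
  rw [hasDerivWithinAt_iff_isLittleO, Asymptotics.isLittleO_iff]
  intro c hc
  obtain ⟨k, hk⟩ := eventually_atTop.1
    (Metric.tendstoUniformlyOn_iff.1 hlim' (c / 4) (by positivity))
  have hlip : ∀ r ∈ s, |(f r - F k r) - (f t - F k t)| ≤ c / 2 * |r - t| := by
    intro r hr
    have h1 : Tendsto (fun l => |(F l r - F k r) - (F l t - F k t)|) atTop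
        (𝓝 |(f r - F k r) - (f t - F k t)|) :=
      (((hlim r hr).sub_const _).sub ((hlim t ht).sub_const _)).abs
    refine le_of_tendsto h1 (eventually_atTop.2 ⟨k, fun l hl => ?_⟩)
    refine hs.norm_image_sub_le_of_norm_hasDerivWithin_le (f := fun z => F l z - F k z)
      (fun z hz => (hF l z hz).sub (hF k z hz)) (fun z hz => ?_) ht hr
    have h2 := hk l hl z hz
    have h3 := hk k le_rfl z hz
    rw [dist_comm] at h2
    have h4 := dist_triangle (F' l z) (f' z) (F' k z)
    rw [← dist_eq_norm]
    linarith
  have h := (hasDerivWithinAt_iff_isLittleO.1 (hF k t ht)).def (show 0 < c / 4 by positivity)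
  filter_upwards [h, self_mem_nhdsWithin] with r h1 hr
  have h2 := hlip r hr
  have h3 := hk k le_rfl t ht
  rw [Real.dist_eq] at h3
  simp only [Real.norm_eq_abs, smul_eq_mul] at h1 ⊢
  have h4 : |(r - t) * (F' k t - f' t)| ≤ c / 4 * |r - t| := by
    rw [abs_mul, mul_comm, abs_sub_comm (F' k t)]
    exact mul_le_mul_of_nonneg_right h3.le (abs_nonneg _)
  have e : f r - f t - (r - t) * f' t = ((f r - F k r) - (f t - F k t)) +
      (F k r - F k t - (r - t) * F' k t) + (r - t) * (F' k t - f' t) := by ring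
  rw [e]
  have h5 := abs_add_three ((f r - F k r) - (f t - F k t))
    (F k r - F k t - (r - t) * F' k t) ((r - t) * (F' k t - f' t))
  linarith

theorem normLE_of_support {b M : ℕ} {x : ℕ → ℝ} {B : ℝ} (hx : ∀ n, M ≤ n → x n = 0)
    (h : ∑ n ∈ Finset.range M, wt b n * |x n| ≤ B) : NormLE b x B := by
  intro K
  refine le_trans ?_ h
  calc ∑ n ∈ Finset.range K, wt b n * |x n|
      ≤ ∑ n ∈ Finset.range (max K M), wt b n * |x n| :=
        Finset.sum_le_sum_of_subset_of_nonneg (Finset.range_subset_range.2 (le_max_left _ _))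
          fun n _ _ => mul_nonneg (wt_pos _ n).le (abs_nonneg _)
    _ = ∑ n ∈ Finset.range M, wt b n * |x n| := by
        refine (Finset.sum_subset (Finset.range_subset_range.2 (le_max_right _ _))
          fun n _ hn => ?_).symm
        rw [hx n (by simpa using hn), abs_zero, mul_zero]

theorem normLE_of_tendsto {b : ℕ} {X : ℕ → ℕ → ℝ} {x : ℕ → ℝ} {B : ℝ}
    (hx : ∀ n, Tendsto (fun k => X k n) atTop (𝓝 (x n))) (h : ∀ᶠ k in atTop, NormLE b (X k) B) :
    NormLE b x B := fun K =>
  le_of_tendsto (tendsto_finsetSum (Finset.range K) fun n _ => ((hx n).abs.const_mul (wt b n)))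
    (h.mono fun _ hk => hk K)

theorem NormLE.abs_formalL_le {b : ℕ} {x : ℕ → ℝ} {B : ℝ} (h : NormLE b x B) (q : ℝ[X]) (n : ℕ) :
    |formalL q x n| ≤
      (n * ∑ j ∈ Finset.range (q.natDegree + 1), |q.coeff j| / wt b (n + j - 1)) * B := by
  rw [formalL, abs_mul, Nat.abs_cast, mul_assoc, Finset.sum_mul]
  refine mul_le_mul_of_nonneg_left ((Finset.abs_sum_le_sum_abs _ _).trans
    (Finset.sum_le_sum fun j _ => ?_)) (Nat.cast_nonneg n)
  rw [abs_mul, div_mul_eq_mul_div, mul_div_assoc]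
  refine mul_le_mul_of_nonneg_left ?_ (abs_nonneg _)
  rw [le_div_iff₀ (wt_pos b _), mul_comm]
  exact h.abs_apply_le _

/-- Continuity on `[0, T]` in the norm with weights `(n + 1)^{-b}`. -/
def NormContinuousOn (b : ℕ) (T : ℝ) (u : ℝ → ℕ → ℝ) : Prop :=
  ∀ t ∈ Set.Icc 0 T, ∀ ε > 0, ∀ᶠ r in 𝓝[Set.Icc 0 T] t, NormLE b (fun n => u r n - u t n) ε

/-- A uniform limit, in norm, of continuous functions with values in finitely supported sequences
is continuous in norm. -/
theorem normContinuousOn_of_approx {b : ℕ} {T : ℝ} {u : ℝ → ℕ → ℝ} {U : ℕ → ℝ → ℕ → ℝ} {m : ℕ → ℕ}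
    {ε : ℕ → ℝ} (hε : Tendsto ε atTop (𝓝 0)) (hm : ∀ k t n, m k ≤ n → U k t n = 0)
    (hU : ∀ k n, Continuous fun t => U k t n)
    (hu : ∀ k, ∀ t ∈ Set.Icc 0 T, NormLE b (fun n => u t n - U k t n) (ε k)) :
    NormContinuousOn b T u := by
  intro t ht η hη
  obtain ⟨k, hk⟩ := (hε.eventually_lt_const (show 0 < η / 3 by positivity)).exists
  have hc : Continuous fun r => ∑ n ∈ Finset.range (m k), wt b n * |U k r n - U k t n| :=
    continuous_finsetSum _ fun n _ => continuous_const.mul ((hU k n).sub continuous_const).abs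
  have h0 : ∑ n ∈ Finset.range (m k), wt b n * |U k t n - U k t n| < η / 3 := by
    simpa using (by positivity : 0 < η / 3)
  filter_upwards [mem_nhdsWithin_of_mem_nhds (hc.continuousAt.eventually_lt_const h0),
    self_mem_nhdsWithin] with r hr hrT
  have h1 : NormLE b (fun n => U k r n - U k t n) (η / 3) :=
    normLE_of_support (M := m k) (fun n hn => by rw [hm k r n hn, hm k t n hn, sub_zero]) hr.le
  have h2 := ((hu k r hrT).sub (hu k t ht)).add h1
  have e : (fun n => (u r n - U k r n) - (u t n - U k t n) + (U k r n - U k t n)) =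
      fun n => u r n - u t n := by
    funext n
    ring
  rw [e] at h2
  exact h2.mono (by linarith)

/-- Existence of a solution for every initial value with finite norm. The approximations solve the
system truncated to `(k + 1) ^ 3` entries, with only the first `k + 1` entries of the initial value.
Truncating the initial value costs a factor `(k + 1) ^ 2` when passing to the stronger norm with
exponent `b`, in which the error of truncating the system is of order `(k + 1) ^ (-3)`. -/
theorem exists_solution {q : ℝ[X]} (hq : SignCond q) (b : ℕ) {a : ℕ → ℝ} {A T : ℝ} (hT : 0 ≤ T)
    (hA : NormLE (b + 2) a A) :
    ∃ u : ℝ → ℕ → ℝ, u 0 = a ∧ (∃ B, ∀ t ∈ Set.Icc 0 T, NormLE (b + 2) (u t) B) ∧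
      (∀ n, ∀ t ∈ Set.Icc 0 T,
        HasDerivWithinAt (fun r => u r n) (formalL q (u t) n) (Set.Icc 0 T) t) ∧
      NormContinuousOn (b + 2) T u := by
  set m : ℕ → ℕ := fun k => (k + 1) ^ 3 with hm
  have hm_pos : ∀ k, 0 < m k := fun k => by positivity
  have hm_ge : ∀ k, k + 1 ≤ m k := fun k => Nat.le_self_pow (by norm_num) _
  have hm_mono : ∀ k l, k ≤ l → m k ≤ m l := fun k l h => Nat.pow_le_pow_left (by omega) 3
  set α : ℕ → ℕ → ℝ := fun k n => if n ≤ k then a n else 0 with hα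
  have hα_le : ∀ k n, |α k n| ≤ |a n| := fun k n => by
    by_cases h : n ≤ k <;> simp [hα, h]
  have hα0 : ∀ k n, m k ≤ n → α k n = 0 := fun k n hn => by
    have := hm_ge k
    simp [hα, show ¬ n ≤ k by omega]
  choose U hU0 hUsupp hUd using fun k => exists_truncated_solution q (hm_pos k) (hα0 k)
  have hAα : ∀ k, NormLE (b + 2) (α k) A := fun k => hA.of_abs_le (hα_le k)
  -- The truncated solutions are bounded in every norm: no boundary term arises, since they vanish
  -- beyond the truncation.
  have hbound : ∀ (b' k : ℕ) (A' : ℝ), NormLE b' (α k) A' → ∀ t ∈ Set.Icc 0 T,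
      NormLE b' (U k t) (A' * Real.exp (growthRate q b' * T)) := by
    intro b' k A' hA' t ht
    refine normLE_of_support (hUsupp k t) ?_
    have h := sum_range_wt_le hq b' (m k) (u := U k) (s := fun _ _ => 0) (T := T) (A := A')
      (ε := 0) (fun n hn t _ => ?_) (by rw [hU0]; exact hA' _) (fun t _ => ?_) t ht
    · simpa using h
    · have := (hUd k t n).hasDerivWithinAt (s := Set.Icc 0 T)
      rw [if_neg hn.ne, sub_zero] at this
      simpa using this
    · have : ∑ i ∈ Finset.Ico (m k) (m k + q.natDegree),
          (i + shiftConst b' q.natDegree) * wt b' i * |U k t i| = 0 :=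
        Finset.sum_eq_zero fun i hi => by
          rw [hUsupp k t i (Finset.mem_Ico.1 hi).1, abs_zero, mul_zero]
      simp [this]
  set E := Real.exp (growthRate q b * T) with hE
  set E₂ := Real.exp (growthRate q (b + 2) * T) with hE₂
  have hA0 := hA.nonneg
  have hq0 := hq.coeff_zero_nonneg
  -- The contribution missing from row `m k`, which is the error of truncating the system.
  have hsource : ∀ k, ∀ t ∈ Set.Icc 0 T,
      wt (b + 2) (m k) * |(m k : ℝ) * (q.coeff 0 * U k t (m k - 1))| ≤
        q.coeff 0 * (A * E) * (1 / ((k : ℝ) + 1)) := by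
    intro k t ht
    have h1 : NormLE b (α k) (((k : ℝ) + 1) ^ 2 * A) := by
      intro K
      refine le_trans ?_ (mul_le_mul_of_nonneg_left (hAα k K) (by positivity))
      rw [Finset.mul_sum]
      refine Finset.sum_le_sum fun n _ => ?_
      by_cases h : n ≤ k
      · rw [← mul_assoc]
        refine mul_le_mul_of_nonneg_right ?_ (abs_nonneg _)
        have hnk : (n : ℝ) ≤ k := by exact_mod_cast h
        rw [wt_add_two, mul_div_assoc', le_div_iff₀ (by positivity), mul_comm]
        refine mul_le_mul_of_nonneg_right ?_ (wt_pos b n).le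
        gcongr
      · simp [hα, h]
    have h2 := (hbound b k _ h1 t ht).abs_apply_le (m k - 1)
    have hj : ((m k - 1 : ℕ) : ℝ) + 1 = m k := by
      rw [Nat.cast_pred (hm_pos k)]
      ring
    have hmR : (m k : ℝ) = ((k : ℝ) + 1) ^ 3 := by
      rw [hm]
      push_cast
      ring
    have hk : (0 : ℝ) < (k : ℝ) + 1 := by positivity
    have h3 : wt (b + 2) (m k) ≤ wt b (m k - 1) / (m k : ℝ) ^ 2 := by
      have h4 := wt_add_two b (m k - 1)
      rw [hj] at h4
      rw [← h4]
      unfold wt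
      rw [hj]
      have : (0 : ℝ) < m k := by exact_mod_cast hm_pos k
      gcongr
      linarith
    rw [abs_mul, abs_mul, Nat.abs_cast, abs_of_nonneg hq0]
    calc wt (b + 2) (m k) * ((m k : ℝ) * (q.coeff 0 * |U k t (m k - 1)|))
        ≤ wt b (m k - 1) / (m k : ℝ) ^ 2 * ((m k : ℝ) * (q.coeff 0 * |U k t (m k - 1)|)) :=
          mul_le_mul_of_nonneg_right h3 (by positivity)
      _ = q.coeff 0 / (m k : ℝ) * (wt b (m k - 1) * |U k t (m k - 1)|) := by
          rw [hmR]
          field_simp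
      _ ≤ q.coeff 0 / (m k : ℝ) * (((k : ℝ) + 1) ^ 2 * A * E) :=
          mul_le_mul_of_nonneg_left h2 (by positivity)
      _ = q.coeff 0 * (A * E) * (1 / ((k : ℝ) + 1)) := by
          rw [hmR]
          field_simp
  have hsummable : Summable fun n => wt (b + 2) n * |a n| :=
    summable_of_sum_range_le (fun n => mul_nonneg (wt_pos _ n).le (abs_nonneg _)) hA
  set tail : ℕ → ℝ := fun k => ∑' n, wt (b + 2) n * |a n| -
    ∑ n ∈ Finset.range (k + 1), wt (b + 2) n * |a n| with htail
  have htail0 : Tendsto tail atTop (𝓝 0) := by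
    have := (hsummable.hasSum.tendsto_sum_nat.comp (tendsto_add_atTop_nat 1)).const_sub
      (∑' n, wt (b + 2) n * |a n|)
    simpa using this
  set ε : ℕ → ℝ := fun k => (tail k + q.coeff 0 * (A * E) * (1 / ((k : ℝ) + 1))) * E₂ with hε
  have hε0 : Tendsto ε atTop (𝓝 0) := by
    have := (htail0.add (tendsto_one_div_add_atTop_nhds_zero_nat.const_mul
      (q.coeff 0 * (A * E)))).mul_const E₂
    simpa only [mul_zero, add_zero, zero_mul] using this
  -- For `k ≤ l` the difference solves the first `m l` rows, with the missing contribution to row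
  -- `m k` as the only inhomogeneity.
  have hcauchy : ∀ k l, k ≤ l → ∀ t ∈ Set.Icc 0 T,
      NormLE (b + 2) (fun n => U l t n - U k t n) (ε k) := by
    intro k l hkl t ht
    have hvan : ∀ r n, m l ≤ n → U l r n - U k r n = 0 := fun r n hn => by
      rw [hUsupp l r n hn, hUsupp k r n ((hm_mono k l hkl).trans hn), sub_zero]
    refine normLE_of_support (hvan t) ?_
    refine sum_range_wt_le hq (b + 2) (m l) (u := fun t n => U l t n - U k t n)
      (s := fun t n => if n = m k then (m k : ℝ) * (q.coeff 0 * U k t (m k - 1)) else 0)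
      (fun n hn t _ => ?_) ?_ (fun t ht => ?_) t ht
    · have h := ((hUd l t n).sub (hUd k t n)).hasDerivWithinAt (s := Set.Icc 0 T)
      rw [if_neg hn.ne] at h
      refine h.congr_deriv ?_
      rw [formalL_sub]
      ring
    · rw [hU0, hU0]
      have hlm : k + 1 ≤ m l := (Nat.succ_le_succ hkl).trans (hm_ge l)
      rw [htail]
      have h1 := (hsummable.sum_le_tsum (Finset.range (m l))
        (fun n _ => mul_nonneg (wt_pos _ n).le (abs_nonneg _)))
      have h2 := Finset.sum_range_add_sum_Ico (fun n => wt (b + 2) n * |a n|) hlm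
      have h3 := Finset.sum_range_add_sum_Ico (fun n => wt (b + 2) n * |α l n - α k n|) hlm
      have h4 : ∑ n ∈ Finset.range (k + 1), wt (b + 2) n * |α l n - α k n| = 0 := by
        refine Finset.sum_eq_zero fun n hn => ?_
        have hn' : n ≤ k := Nat.lt_succ_iff.1 (Finset.mem_range.1 hn)
        simp [hα, hn', hn'.trans hkl]
      have h5 : ∑ n ∈ Finset.Ico (k + 1) (m l), wt (b + 2) n * |α l n - α k n| ≤
          ∑ n ∈ Finset.Ico (k + 1) (m l), wt (b + 2) n * |a n| := by
        refine Finset.sum_le_sum fun n hn => mul_le_mul_of_nonneg_left ?_ (wt_pos _ n).le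
        have hn' : ¬ n ≤ k := by
          have := (Finset.mem_Ico.1 hn).1
          omega
        have : α k n = 0 := by simp [hα, hn']
        rw [this, sub_zero]
        exact hα_le l n
      linarith
    · have h1 : ∑ i ∈ Finset.Ico (m l) (m l + q.natDegree),
          (i + shiftConst (b + 2) q.natDegree) * wt (b + 2) i * |U l t i - U k t i| = 0 :=
        Finset.sum_eq_zero fun i hi => by
          rw [hvan t i (Finset.mem_Ico.1 hi).1, abs_zero, mul_zero]
      rw [h1, mul_zero, add_zero]
      refine le_trans ?_ (hsource k t ht)
      have h2 : ∀ n, wt (b + 2) n * |if n = m k then (m k : ℝ) * (q.coeff 0 * U k t (m k - 1))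
          else 0| = if n = m k then
            wt (b + 2) (m k) * |(m k : ℝ) * (q.coeff 0 * U k t (m k - 1))| else 0 := by
        intro n
        split_ifs with h
        · rw [h]
        · simp
      simp only [h2, Finset.sum_ite_eq']
      split_ifs
      · exact le_rfl
      · exact mul_nonneg (wt_pos _ _).le (abs_nonneg _)
  set u : ℝ → ℕ → ℝ := fun t n => limUnder atTop fun k => U k t n with hu
  have hlim : ∀ t ∈ Set.Icc 0 T, ∀ n, Tendsto (fun k => U k t n) atTop (𝓝 (u t n)) := by
    intro t ht n
    refine CauchySeq.tendsto_limUnder (cauchySeq_of_le_tendsto_0' (fun k => ε k / wt (b + 2) n)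
      (fun k l hkl => ?_) (by simpa using hε0.div_const (wt (b + 2) n)))
    rw [dist_comm, Real.dist_eq, le_div_iff₀ (wt_pos _ n), mul_comm]
    exact (hcauchy k l hkl t ht).abs_apply_le n
  have happrox : ∀ k, ∀ t ∈ Set.Icc 0 T, NormLE (b + 2) (fun n => u t n - U k t n) (ε k) :=
    fun k t ht => normLE_of_tendsto (fun n => (hlim t ht n).sub_const _)
      (eventually_atTop.2 ⟨k, fun l hl => hcauchy k l hl t ht⟩)
  refine ⟨u, ?_, ⟨ε 0 + A * E₂, fun t ht => ?_⟩, fun n t ht => ?_, ?_⟩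
  · funext n
    refine tendsto_nhds_unique (hlim 0 ⟨le_rfl, hT⟩ n) (tendsto_const_nhds.congr' ?_)
    filter_upwards [eventually_ge_atTop n] with k hk
    rw [hU0]
    simp [hα, hk]
  · simpa using (happrox 0 t ht).add (hbound (b + 2) 0 A (hAα 0) t ht)
  · refine hasDerivWithinAt_of_uniform_limit (f' := fun t => formalL q (u t) n) (convex_Icc 0 T)
      (fun k t _ => (hUd k t n).hasDerivWithinAt) (fun t ht => hlim t ht n) ?_ ht
    rw [Metric.tendstoUniformlyOn_iff]
    intro η hη
    set G : ℝ := n * ∑ j ∈ Finset.range (q.natDegree + 1), |q.coeff j| / wt (b + 2) (n + j - 1)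
    have hG : Tendsto (fun k => G * ε k) atTop (𝓝 0) := by simpa using hε0.const_mul G
    filter_upwards [hG.eventually_lt_const hη, eventually_ge_atTop n] with k hk hkn t ht
    have hne : n ≠ m k := by
      have := hm_ge k
      omega
    rw [if_neg hne, sub_zero, Real.dist_eq, ← formalL_sub]
    exact ((happrox k t ht).abs_formalL_le q n).trans_lt hk
  · exact normContinuousOn_of_approx hε0 hUsupp
      (fun k n => continuous_iff_continuousAt.2 fun t => (hUd k t n).continuousAt) happrox

/-! ### The Markov chain and its moments -/

theorem rate_top {β : ℝ[X]} (hβ1 : β.eval 1 = 0) {N : ℕ} (hN : 1 ≤ N) : rate β N N = 0 := by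
  have : (N : ℝ) ≠ 0 := by positivity
  rw [rate, div_self this, hβ1, mul_zero]

theorem rate_zero {δ : ℝ[X]} (hδ0 : δ.eval 0 = 0) (N : ℕ) : rate δ N 0 = 0 := by
  simp [rate, hδ0]

theorem div_mem_Icc {N k : ℕ} (hk : k ≤ N) : (k : ℝ) / N ∈ Set.Icc (0 : ℝ) 1 :=
  ⟨by positivity, div_le_one_of_le₀ (by exact_mod_cast hk) (Nat.cast_nonneg N)⟩

theorem rate_nonneg {β : ℝ[X]} (hβ : ∀ x ∈ Set.Icc (0 : ℝ) 1, 0 ≤ β.eval x) {N k : ℕ}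
    (hk : k ≤ N) : 0 ≤ rate β N k :=
  mul_nonneg (Nat.cast_nonneg N) (hβ _ (div_mem_Icc hk))

/-- The Kolmogorov equations tested with a function `φ` of the state: the generator of the chain
acts on `φ`. At `k = 0` the truncated subtraction in `φ (k - 1)` is harmless, since there is no
death in that state. -/
theorem sum_mul_kolmogorovRHS {β δ : ℝ[X]} {N : ℕ} (hβN : rate β N N = 0) (hδ0 : rate δ N 0 = 0)
    (φ x : ℕ → ℝ) :
    ∑ k ∈ Finset.range (N + 1), φ k * kolmogorovRHS β δ N x k =
      ∑ k ∈ Finset.range (N + 1),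
        (rate β N k * (φ (k + 1) - φ k) + rate δ N k * (φ (k - 1) - φ k)) * x k := by
  have h1 : ∑ k ∈ Finset.range (N + 1), φ k * (if k = 0 then 0 else
      rate β N (k - 1) * x (k - 1)) =
      ∑ k ∈ Finset.range (N + 1), φ (k + 1) * (rate β N k * x k) := by
    rw [Finset.sum_range_succ', Finset.sum_range_succ (fun k => φ (k + 1) * (rate β N k * x k)),
      hβN]
    simp
  have h2 : ∑ k ∈ Finset.range (N + 1), φ k * (if k < N then
      rate δ N (k + 1) * x (k + 1) else 0) =
      ∑ k ∈ Finset.range (N + 1), φ (k - 1) * (rate δ N k * x k) := by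
    rw [Finset.sum_range_succ, Finset.sum_range_succ' (fun k => φ (k - 1) * (rate δ N k * x k)),
      hδ0]
    simp only [lt_irrefl, if_false, mul_zero, zero_mul, add_zero, Nat.add_sub_cancel]
    exact Finset.sum_congr rfl fun k hk => by rw [if_pos (Finset.mem_range.1 hk)]
  simp only [kolmogorovRHS, mul_add, mul_sub, Finset.sum_add_distrib, Finset.sum_sub_distrib]
  rw [h1, h2, ← Finset.sum_sub_distrib, ← Finset.sum_add_distrib]
  exact Finset.sum_congr rfl fun k _ => by ring

/-- The Kolmogorov equations contract the `ℓ¹` norm. This bounds the law of the chain without a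
separate proof that it stays nonnegative. -/
theorem sum_abs_chainLaw_le {β δ : ℝ[X]} (hβ : ∀ x ∈ Set.Icc (0 : ℝ) 1, 0 ≤ β.eval x)
    (hδ : ∀ x ∈ Set.Icc (0 : ℝ) 1, 0 ≤ δ.eval x) (hβ1 : β.eval 1 = 0) (hδ0 : δ.eval 0 = 0)
    {N : ℕ} (hN : 1 ≤ N) {p : ℝ → ℕ → ℝ} (hp : IsChainLaw β δ N p) {t : ℝ} (ht : 0 ≤ t) :
    ∑ k ∈ Finset.range (N + 1), |p t k| ≤ 1 := by
  have h := sum_abs_le_gronwallBound (Finset.range (N + 1)) (v := fun _ => 1)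
    (fun _ => zero_le_one) (u := p) (u' := fun t k => kolmogorovRHS β δ N (p t) k)
    (R := fun t k => (if k = 0 then 0 else rate β N (k - 1) * |p t (k - 1)|) +
      (if k < N then rate δ N (k + 1) * |p t (k + 1)| else 0))
    (c := fun k => -(rate β N k + rate δ N k)) (T := t) (ω := 0) (ε := 0) (A := 1)
    (fun k hk s hs => (hp.kolmogorov k (Nat.lt_succ_iff.1 (Finset.mem_range.1 hk)) s hs.1).mono
      fun r hr => hr.1) (fun k hk s _ => ?_) ?_ (fun s _ => ?_) t ⟨ht, le_rfl⟩
  · simpa [gronwallBound_K0] using h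
  · have hk' : k ≤ N := Nat.lt_succ_iff.1 (Finset.mem_range.1 hk)
    have e : kolmogorovRHS β δ N (p s) k - -(rate β N k + rate δ N k) * p s k =
        (if k = 0 then 0 else rate β N (k - 1) * p s (k - 1)) +
        (if k < N then rate δ N (k + 1) * p s (k + 1) else 0) := by
      unfold kolmogorovRHS
      ring
    rw [e]
    refine (abs_add_le _ _).trans (add_le_add ?_ ?_)
    · split_ifs
      · simp
      · rw [abs_mul, abs_of_nonneg (rate_nonneg hβ (by omega))]
    · split_ifs
      · rw [abs_mul, abs_of_nonneg (rate_nonneg hδ (by omega))]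
      · simp
  · refine (Finset.sum_congr rfl fun k hk => ?_).le.trans hp.init_sum.le
    rw [one_mul, abs_of_nonneg (hp.init_nonneg k (Nat.lt_succ_iff.1 (Finset.mem_range.1 hk)))]
  · have h := sum_mul_kolmogorovRHS (rate_top hβ1 hN) (rate_zero hδ0 N) (fun _ => 1)
      (fun k => |p s k|)
    simp only [sub_self, mul_zero, add_zero, zero_mul, Finset.sum_const_zero] at h
    rw [zero_mul, zero_add]
    refine le_of_eq (Eq.trans (Finset.sum_congr rfl fun k _ => ?_) h)
    unfold kolmogorovRHS
    ring

theorem abs_pow_sub_pow_sub_le {x y : ℝ} (hx : x ∈ Set.Icc (0 : ℝ) 1) (hy : y ∈ Set.Icc (0 : ℝ) 1)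
    (n : ℕ) : |y ^ n - x ^ n - n * x ^ (n - 1) * (y - x)| ≤ (n : ℝ) ^ 2 * (y - x) ^ 2 := by
  induction n with
  | zero => simp
  | succ n ih =>
    have h1 : (n : ℝ) * x ^ n = n * x ^ (n - 1) * x := by
      cases n with
      | zero => simp
      | succ n => rw [Nat.add_sub_cancel, pow_succ]; ring
    have e : y ^ (n + 1) - x ^ (n + 1) - ((n + 1 : ℕ) : ℝ) * x ^ (n + 1 - 1) * (y - x) =
        y * (y ^ n - x ^ n - n * x ^ (n - 1) * (y - x)) + n * x ^ (n - 1) * (y - x) ^ 2 := by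
      rw [Nat.add_sub_cancel, pow_succ, pow_succ]
      push_cast
      linear_combination (-(y - x)) * h1
    rw [e]
    have h2 : |y * (y ^ n - x ^ n - n * x ^ (n - 1) * (y - x))| ≤ (n : ℝ) ^ 2 * (y - x) ^ 2 := by
      rw [abs_mul, abs_of_nonneg hy.1]
      exact (mul_le_of_le_one_left (abs_nonneg _) hy.2).trans ih
    have h3 : |(n : ℝ) * x ^ (n - 1) * (y - x) ^ 2| ≤ n * (y - x) ^ 2 := by
      rw [abs_of_nonneg (mul_nonneg (mul_nonneg (Nat.cast_nonneg n) (pow_nonneg hx.1 _))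
        (sq_nonneg _))]
      refine mul_le_mul_of_nonneg_right ?_ (sq_nonneg _)
      exact mul_le_of_le_one_right (Nat.cast_nonneg n) (pow_le_one₀ hx.1 hx.2)
    refine (abs_add_le _ _).trans ((add_le_add h2 h3).trans ?_)
    rw [← add_mul]
    refine mul_le_mul_of_nonneg_right ?_ (sq_nonneg _)
    push_cast
    nlinarith [(Nat.cast_nonneg n : (0 : ℝ) ≤ n)]

theorem remR_eq {N k n : ℕ} (hN : 1 ≤ N) : remR N k n =
    N * ((((k + 1 : ℕ) : ℝ) / N) ^ n - ((k : ℝ) / N) ^ n -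
      n * ((k : ℝ) / N) ^ (n - 1) * (((k + 1 : ℕ) : ℝ) / N - (k : ℝ) / N)) := by
  have hN' : (N : ℝ) ≠ 0 := by positivity
  cases n with
  | zero => simp [remR]
  | succ n =>
    simp only [remR, Nat.add_sub_cancel, div_pow, pow_succ]
    push_cast
    field_simp
    ring

theorem remQ_eq {N k n : ℕ} (hN : 1 ≤ N) : remQ N (k + 1) n =
    N * (((k : ℝ) / N) ^ n - (((k + 1 : ℕ) : ℝ) / N) ^ n -
      n * (((k + 1 : ℕ) : ℝ) / N) ^ (n - 1) * ((k : ℝ) / N - ((k + 1 : ℕ) : ℝ) / N)) := by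
  have hN' : (N : ℝ) ≠ 0 := by positivity
  cases n with
  | zero => simp [remQ]
  | succ n =>
    simp only [remQ, Nat.add_sub_cancel, div_pow, pow_succ]
    push_cast
    field_simp
    ring

theorem abs_rate_mul_le {β : ℝ[X]} {C e : ℝ} (hC : ∀ x ∈ Set.Icc (0 : ℝ) 1, |β.eval x| ≤ C)
    {N k n : ℕ} (hN : 1 ≤ N) (hk : k ≤ N) (he : |e| ≤ (n : ℝ) ^ 2 * (1 / N) ^ 2) :
    |rate β N k * (N * e)| ≤ C * (n : ℝ) ^ 2 := by
  have hN' : (0 : ℝ) < N := by positivity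
  have h1 := hC _ (div_mem_Icc hk)
  rw [rate, abs_mul, abs_mul, abs_mul, Nat.abs_cast]
  calc (N : ℝ) * |β.eval ((k : ℝ) / N)| * (N * |e|)
      ≤ N * C * (N * ((n : ℝ) ^ 2 * (1 / N) ^ 2)) := by
        have := (abs_nonneg _).trans h1
        gcongr
    _ = C * (n : ℝ) ^ 2 := by field_simp

/-- The Taylor remainders in `d_n` are of order `n ^ 2`, uniformly in `N` and in the state. Since
there is no birth in the state `N` and no death in the state `0`, only points of `[0, 1]` enter. -/
theorem abs_dTerm_le {β δ : ℝ[X]} (hβ1 : β.eval 1 = 0) (hδ0 : δ.eval 0 = 0) {Cβ Cδ : ℝ}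
    (hCβ : ∀ x ∈ Set.Icc (0 : ℝ) 1, |β.eval x| ≤ Cβ)
    (hCδ : ∀ x ∈ Set.Icc (0 : ℝ) 1, |δ.eval x| ≤ Cδ) {N : ℕ} (hN : 1 ≤ N) {x : ℕ → ℝ}
    (hx : ∑ k ∈ Finset.range (N + 1), |x k| ≤ 1) (n : ℕ) :
    |dTerm β δ N x n| ≤ (Cβ + Cδ) * (n : ℝ) ^ 2 := by
  have hN' : (0 : ℝ) < N := by positivity
  have hCβ0 : 0 ≤ Cβ := (abs_nonneg _).trans (hCβ 0 (by simp))
  have hCδ0 : 0 ≤ Cδ := (abs_nonneg _).trans (hCδ 0 (by simp))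
  have hstep : ∀ k : ℕ, ((k + 1 : ℕ) : ℝ) / N - (k : ℝ) / N = 1 / N := fun k => by
    push_cast
    ring
  have hR : ∀ k ≤ N, |rate β N k * remR N k n| ≤ Cβ * (n : ℝ) ^ 2 := by
    intro k hk
    rcases hk.eq_or_lt with rfl | hk'
    · rw [rate_top hβ1 hN, zero_mul, abs_zero]
      positivity
    · rw [remR_eq hN]
      refine abs_rate_mul_le hCβ hN hk ?_
      rw [← hstep k]
      exact abs_pow_sub_pow_sub_le (div_mem_Icc hk) (div_mem_Icc hk') n
  have hQ : ∀ k ≤ N, |rate δ N k * remQ N k n| ≤ Cδ * (n : ℝ) ^ 2 := by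
    intro k hk
    cases k with
    | zero =>
      rw [rate_zero hδ0, zero_mul, abs_zero]
      positivity
    | succ k =>
      rw [remQ_eq hN]
      refine abs_rate_mul_le hCδ hN hk ?_
      rw [← hstep k, ← neg_sq (((k + 1 : ℕ) : ℝ) / N - (k : ℝ) / N), neg_sub]
      exact abs_pow_sub_pow_sub_le (div_mem_Icc hk) (div_mem_Icc (by omega)) n
  calc |dTerm β δ N x n|
      ≤ ∑ k ∈ Finset.range (N + 1), (Cβ + Cδ) * (n : ℝ) ^ 2 * |x k| := by
        refine (Finset.abs_sum_le_sum_abs _ _).trans (Finset.sum_le_sum fun k hk => ?_)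
        have hk' : k ≤ N := Nat.lt_succ_iff.1 (Finset.mem_range.1 hk)
        rw [abs_mul, add_mul Cβ]
        exact mul_le_mul_of_nonneg_right
          ((abs_add_le _ _).trans (add_le_add (hR k hk') (hQ k hk'))) (abs_nonneg _)
    _ ≤ (Cβ + Cδ) * (n : ℝ) ^ 2 := by
        rw [← Finset.mul_sum]
        exact mul_le_of_le_one_right (by positivity) hx

theorem abs_moment_le {N : ℕ} (x : ℕ → ℝ) (n : ℕ) :
    |moment N x n| ≤ ∑ k ∈ Finset.range (N + 1), |x k| := by
  refine (Finset.abs_sum_le_sum_abs _ _).trans (Finset.sum_le_sum fun k hk => ?_)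
  have h := div_mem_Icc (Nat.lt_succ_iff.1 (Finset.mem_range.1 hk))
  rw [abs_mul, abs_of_nonneg (pow_nonneg h.1 n)]
  exact mul_le_of_le_one_left (abs_nonneg _) (pow_le_one₀ h.1 h.2)

theorem formalL_moment (q : ℝ[X]) (N : ℕ) (x : ℕ → ℝ) (n : ℕ) :
    formalL q (moment N x) (n + 1) = ∑ k ∈ Finset.range (N + 1),
      ((n + 1 : ℕ) : ℝ) * ((k : ℝ) / N) ^ n * q.eval ((k : ℝ) / N) * x k := by
  simp only [formalL, moment, Finset.mul_sum]
  rw [Finset.sum_comm]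
  refine Finset.sum_congr rfl fun k _ => ?_
  rw [Polynomial.eval_eq_sum_range, Finset.mul_sum, Finset.sum_mul]
  refine Finset.sum_congr rfl fun j _ => ?_
  rw [show n + 1 + j - 1 = n + j by omega, pow_add]
  ring

/-- The moment equations. The row of index `0` expresses the conservation of mass. -/
theorem hasDerivWithinAt_moment {β δ : ℝ[X]} (hβ1 : β.eval 1 = 0) (hδ0 : δ.eval 0 = 0)
    {N : ℕ} (hN : 1 ≤ N) {p : ℝ → ℕ → ℝ} (hp : IsChainLaw β δ N p) (n : ℕ) {t : ℝ} (ht : 0 ≤ t) :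
    HasDerivWithinAt (fun r => moment N (p r) n)
      (formalL (β - δ) (moment N (p t)) n + dTerm β δ N (p t) n / N) (Set.Ici 0) t := by
  have hN' : (N : ℝ) ≠ 0 := by positivity
  have h : HasDerivWithinAt (fun r => moment N (p r) n) (∑ k ∈ Finset.range (N + 1),
      ((k : ℝ) / N) ^ n * kolmogorovRHS β δ N (p t) k) (Set.Ici 0) t :=
    HasDerivWithinAt.fun_sum fun k hk =>
      (hp.kolmogorov k (Nat.lt_succ_iff.1 (Finset.mem_range.1 hk)) t ht).const_mul _
  refine h.congr_deriv ?_
  rw [sum_mul_kolmogorovRHS (rate_top hβ1 hN) (rate_zero hδ0 N) fun k => ((k : ℝ) / N) ^ n]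
  cases n with
  | zero => simp [formalL_zero, dTerm, remR, remQ]
  | succ n =>
    rw [formalL_moment, dTerm, Finset.sum_div, ← Finset.sum_add_distrib]
    refine Finset.sum_congr rfl fun k _ => ?_
    have hR : rate β N k * ((((k + 1 : ℕ) : ℝ) / N) ^ (n + 1) - ((k : ℝ) / N) ^ (n + 1)) =
        ((n + 1 : ℕ) : ℝ) * ((k : ℝ) / N) ^ n * β.eval ((k : ℝ) / N) +
          rate β N k * remR N k (n + 1) / N := by
      rw [remR_eq hN, rate, Nat.add_sub_cancel]
      push_cast
      field_simp
      ring
    have hQ : rate δ N k * ((((k - 1 : ℕ) : ℝ) / N) ^ (n + 1) - ((k : ℝ) / N) ^ (n + 1)) =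
        -(((n + 1 : ℕ) : ℝ) * ((k : ℝ) / N) ^ n * δ.eval ((k : ℝ) / N)) +
          rate δ N k * remQ N k (n + 1) / N := by
      cases k with
      | zero => simp [rate_zero hδ0, hδ0]
      | succ k =>
        rw [remQ_eq hN, rate, Nat.add_sub_cancel, Nat.add_sub_cancel]
        push_cast
        field_simp
        ring
    rw [hR, hQ, Polynomial.eval_sub]
    ring

theorem summable_wt_two : Summable fun n => wt 2 n := by
  have h := (summable_nat_add_iff 1).2 (Real.summable_nat_pow_inv.2 (by norm_num : 1 < 2))
  refine h.congr fun n => ?_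
  simp [wt]

theorem normLE_moment {N : ℕ} {x : ℕ → ℝ} {c : ℝ}
    (hx : ∑ k ∈ Finset.range (N + 1), |x k| ≤ c) :
    NormLE 2 (moment N x) (c * ∑' n, wt 2 n) := by
  intro K
  have hc : 0 ≤ c := (Finset.sum_nonneg fun k _ => abs_nonneg (x k)).trans hx
  refine le_trans (Finset.sum_le_sum fun n _ => ?_) ((Finset.mul_sum _ _ c).symm.le.trans
    (mul_le_mul_of_nonneg_left
      (summable_wt_two.sum_le_tsum (Finset.range K) fun n _ => (wt_pos 2 n).le) hc))
  rw [mul_comm c]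
  exact mul_le_mul_of_nonneg_left ((abs_moment_le x n).trans hx) (wt_pos 2 n).le

theorem normLE_four_of_abs_le {x : ℕ → ℝ} {c : ℝ} (hx : ∀ n : ℕ, |x n| ≤ c * (n : ℝ) ^ 2) :
    NormLE 4 x (c * ∑' n, wt 2 n) := by
  intro K
  have hc : 0 ≤ c := by simpa using (abs_nonneg _).trans (hx 1)
  refine le_trans (Finset.sum_le_sum fun n _ => ?_) ((Finset.mul_sum _ _ c).symm.le.trans
    (mul_le_mul_of_nonneg_left
      (summable_wt_two.sum_le_tsum (Finset.range K) fun n _ => (wt_pos 2 n).le) hc))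
  have hn : (n : ℝ) ^ 2 ≤ ((n : ℝ) + 1) ^ 2 := by gcongr; linarith
  have hw := wt_pos 2 n
  calc wt 4 n * |x n| ≤ wt 2 n / ((n : ℝ) + 1) ^ 2 * (c * ((n : ℝ) + 1) ^ 2) := by
        rw [wt_add_two 2 n]
        gcongr
        exact (hx n).trans (mul_le_mul_of_nonneg_left hn hc)
    _ = c * wt 2 n := by field_simp

theorem NormContinuousOn.weaken {b b' : ℕ} {T : ℝ} {u : ℝ → ℕ → ℝ} (h : NormContinuousOn b T u)
    (hb : b ≤ b') : NormContinuousOn b' T u := fun t ht ε hε =>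
  (h t ht ε hε).mono fun _ hr => hr.weaken hb

theorem NormContinuousOn.add {b : ℕ} {T : ℝ} {u v : ℝ → ℕ → ℝ} (hu : NormContinuousOn b T u)
    (hv : NormContinuousOn b T v) : NormContinuousOn b T fun t n => u t n + v t n := by
  intro t ht ε hε
  filter_upwards [hu t ht (ε / 2) (half_pos hε), hv t ht (ε / 2) (half_pos hε)] with r h1 h2
  have e : (fun n => u r n + v r n - (u t n + v t n)) =
      fun n => (u r n - u t n) + (v r n - v t n) := by
    funext n
    ring
  rw [e, ← add_halves ε]
  exact h1.add h2

theorem NormContinuousOn.neg {b : ℕ} {T : ℝ} {u : ℝ → ℕ → ℝ} (hu : NormContinuousOn b T u) :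
    NormContinuousOn b T fun t n => -u t n := by
  intro t ht ε hε
  filter_upwards [hu t ht ε hε] with r h1
  refine h1.of_abs_le fun n => ?_
  rw [neg_sub_neg, abs_sub_comm]

theorem normContinuousOn_moment {β δ : ℝ[X]} {N : ℕ} {p : ℝ → ℕ → ℝ} (hp : IsChainLaw β δ N p)
    (T : ℝ) : NormContinuousOn 2 T fun t => moment N (p t) := by
  intro t ht ε hε
  have hc : ContinuousWithinAt (fun r => (∑ k ∈ Finset.range (N + 1), |p r k - p t k|) *
      ∑' n, wt 2 n) (Set.Icc 0 T) t := by
    refine (tendsto_finsetSum _ fun k hk => ?_).mul_const _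
    have h := (hp.kolmogorov k (Nat.lt_succ_iff.1 (Finset.mem_range.1 hk)) t
      ht.1).continuousWithinAt.mono (fun r hr => hr.1 : Set.Icc 0 T ⊆ Set.Ici 0)
    exact (h.sub continuousWithinAt_const).abs
  have h0 : (∑ k ∈ Finset.range (N + 1), |p t k - p t k|) * ∑' n, wt 2 n < ε := by simpa using hε
  filter_upwards [hc.tendsto.eventually_lt_const h0] with r hr
  refine ((normLE_moment (N := N) (x := fun k => p r k - p t k) le_rfl).mono hr.le).of_abs_le
    fun n => le_of_eq ?_
  simp only [moment, mul_sub, Finset.sum_sub_distrib]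

/-! ### Solutions in the weighted space -/

theorem NormLE.memL1 {b : ℕ} {x : ℕ → ℝ} {B : ℝ} (h : NormLE b x B) : MemL1 (wt b) x :=
  (summable_nat_add_iff 1).2
    (summable_of_sum_range_le (fun n => mul_nonneg (wt_pos b n).le (abs_nonneg _)) h)

theorem NormLE.normL1_le {b : ℕ} {x : ℕ → ℝ} {B : ℝ} (h : NormLE b x B) :
    normL1 (wt b) x ≤ B := by
  refine Real.tsum_le_of_sum_range_le (fun n => mul_nonneg (wt_pos b _).le (abs_nonneg _))
    fun K => ?_
  have h1 := h (K + 1)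
  rw [Finset.sum_range_succ'] at h1
  linarith [mul_nonneg (wt_pos b 0).le (abs_nonneg (x 0))]

theorem normLE_of_memL1 {b : ℕ} {x : ℕ → ℝ} (h : MemL1 (wt b) x) :
    NormLE b x (normL1 (wt b) x + wt b 0 * |x 0|) := by
  intro K
  have h0 : ∀ n, 0 ≤ wt b n * |x n| := fun n => mul_nonneg (wt_pos b n).le (abs_nonneg _)
  refine (Finset.sum_le_sum_of_subset_of_nonneg
    (Finset.range_subset_range.2 K.le_succ) fun n _ _ => h0 n).trans ?_
  rw [Finset.sum_range_succ']
  exact add_le_add_left (h.sum_le_tsum (Finset.range K) fun n _ => h0 (n + 1)) _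

theorem isSolution_of_normLE {q : ℝ[X]} {s u : ℝ → ℕ → ℝ} {b : ℕ} {T : ℝ} {a : ℕ → ℝ}
    (hT : 0 ≤ T) (hs : ∀ t ∈ Set.Icc 0 T, s t 0 = 0) (h0 : u 0 = a) (ha : a 0 = 1)
    (hB : ∀ t ∈ Set.Icc 0 T, ∃ B, NormLE b (u t) B)
    (hu : ∀ n, ∀ t ∈ Set.Icc 0 T,
      HasDerivWithinAt (fun r => u r n) (formalL q (u t) n + s t n) (Set.Icc 0 T) t)
    (hc : NormContinuousOn b T u) : IsSolution q s (wt b) T a u where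
  init := h0
  zeroth := by
    intro t ht
    have h := (convex_Icc 0 T).norm_image_sub_le_of_norm_hasDerivWithin_le (hu 0) (C := 0)
      (fun t ht => by rw [formalL_zero, hs t ht, add_zero, norm_zero]) ⟨le_rfl, hT⟩ ht
    rw [zero_mul, norm_le_zero_iff, sub_eq_zero] at h
    rw [h, h0, ha]
  mem := fun t ht => (hB t ht).choose_spec.memL1
  cont := by
    intro t ht
    rw [Metric.tendsto_nhds]
    intro ε hε
    filter_upwards [hc t ht (ε / 2) (half_pos hε)] with r hr
    have h1 : 0 ≤ normL1 (wt b) fun n => u r n - u t n :=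
      tsum_nonneg fun n => mul_nonneg (wt_pos b _).le (abs_nonneg _)
    rw [Real.dist_eq, sub_zero, abs_of_nonneg h1]
    exact hr.normL1_le.trans_lt (half_lt_self hε)
  ode := fun n _ => hu n

/-- By compactness of `[0, T]`, a solution is bounded in norm. Only this consequence of its continuity
enters the uniqueness proof. -/
theorem exists_normLE_of_isSolution {q : ℝ[X]} {s f : ℝ → ℕ → ℝ} {b : ℕ} {T : ℝ} {a : ℕ → ℝ}
    (hf : IsSolution q s (wt b) T a f) : ∃ B, ∀ t ∈ Set.Icc 0 T, NormLE b (f t) B := by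
  suffices ∃ B, ∀ t ∈ Set.Icc 0 T, t ∈ Set.Icc 0 T → NormLE b (f t) B from
    this.imp fun B h t ht => h t ht ht
  refine isCompact_Icc.induction_on (p := fun S => ∃ B, ∀ t ∈ S, t ∈ Set.Icc 0 T →
    NormLE b (f t) B) ⟨0, by simp⟩ ?_ ?_ ?_
  · rintro S S' hS ⟨B, hB⟩
    exact ⟨B, fun t ht => hB t (hS ht)⟩
  · rintro S S' ⟨B, hB⟩ ⟨B', hB'⟩
    refine ⟨max B B', fun t ht htT => ?_⟩
    rcases ht with ht | ht
    · exact (hB t ht htT).mono (le_max_left _ _)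
    · exact (hB' t ht htT).mono (le_max_right _ _)
  · intro t ht
    have hft := normLE_of_memL1 (hf.mem t ht)
    refine ⟨_, (hf.cont t ht).eventually_lt_const zero_lt_one,
      1 + (normL1 (wt b) (f t) + wt b 0 * |f t 0|), fun r hr hrT => ?_⟩
    have h1 := normLE_of_memL1 ((normLE_of_memL1 (hf.mem r hrT)).sub hft).memL1
    rw [hf.zeroth r hrT, hf.zeroth t ht, sub_self, abs_zero, mul_zero, add_zero] at h1
    simpa using (h1.mono (le_of_lt hr)).add hft

/-- Uniqueness: the difference of two solutions is bounded with exponent `b`, so it vanishes by the a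
priori estimate with exponent `b + 2`. -/
theorem eq_of_isSolution {q : ℝ[X]} (hq : SignCond q) {s f g : ℝ → ℕ → ℝ} {b : ℕ} {T : ℝ}
    {a : ℕ → ℝ} (hf : IsSolution q s (wt b) T a f) (hg : IsSolution q s (wt b) T a g) :
    ∀ t ∈ Set.Icc 0 T, f t = g t := by
  obtain ⟨B, hB⟩ := exists_normLE_of_isSolution hf
  obtain ⟨B', hB'⟩ := exists_normLE_of_isSolution hg
  have hzero : NormLE (b + 2) (fun _ => 0) 0 := fun K => by simp
  have h := normLE_of_formalL hq (u := fun t n => f t n - g t n) (s := fun _ _ => 0) (A := 0)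
    (σ := 0) (T := T) (fun n t ht => ?_) (fun t ht => (hB t ht).sub (hB' t ht))
    (by simpa [hf.init, hg.init] using hzero) (fun t _ => hzero)
  · intro t ht
    funext n
    have h1 := (h t ht).abs_apply_le n
    rw [add_zero, zero_mul] at h1
    have h2 := nonpos_of_mul_nonpos_right h1 (wt_pos _ n)
    exact sub_eq_zero.1 (abs_nonpos_iff.1 h2)
  · rcases Nat.eq_zero_or_pos n with rfl | hn
    · rw [formalL_zero, zero_add]
      exact (hasDerivWithinAt_const t (Set.Icc 0 T) (0 : ℝ)).congr
        (fun r hr => by rw [hf.zeroth r hr, hg.zeroth r hr, sub_self])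
        (by rw [hf.zeroth t ht, hg.zeroth t ht, sub_self])
    · refine ((hf.ode n hn t ht).sub (hg.ode n hn t ht)).congr_deriv ?_
      rw [formalL_sub]
      ring

/-! ### Comparison of the moments with the limit system -/

theorem mainTheorem4
    (β δ : ℝ[X])
    -- the transition rates are nonnegative, no birth in the state `N`, no death in the state `0`
    (hβ : ∀ x ∈ Set.Icc (0 : ℝ) 1, 0 ≤ β.eval x)
    (hδ : ∀ x ∈ Set.Icc (0 : ℝ) 1, 0 ≤ δ.eval x)
    (hβ1 : β.eval 1 = 0)
    (hδ0 : δ.eval 0 = 0)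
    -- the sign conditions on the coefficients `q_j` of `β - δ`
    (hq : ∀ j : ℕ, j ≠ 1 → 0 ≤ (β - δ).coeff j)
    (hq1 : (β - δ).coeff 1 ≤ 0)
    (hsum : ∑ j ∈ Finset.range ((β - δ).natDegree + 1), (β - δ).coeff j ≤ 0)
    (hcol : (β - δ).coeff 0
      - ∑ j ∈ Finset.Icc 2 (β - δ).natDegree, ((j : ℝ) - 1) * (β - δ).coeff j ≤ 0) :
    ∃ w : ℕ → ℝ, (∀ n, 0 < w n) ∧
      ∀ T : ℝ, 0 < T → ∃ K : ℝ, ∀ N : ℕ, 1 ≤ N → ∀ p : ℝ → ℕ → ℝ, IsChainLaw β δ N p →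
        -- the perturbation `d(t)` lies in the space
        (∀ t : ℝ, 0 ≤ t → MemL1 w (dTerm β δ N (p t))) ∧
        -- the moment vector solves the moment system in the space
        IsSolution (β - δ) (fun t n => dTerm β δ N (p t) n / N) w T
          (moment N (p 0)) (fun t => moment N (p t)) ∧
        -- for all initial values, both systems are uniquely solvable, with the estimate
        (∀ a : ℕ → ℝ, a 0 = 1 → MemL1 w a →
          ∃ y f : ℝ → ℕ → ℝ,
            IsUniqueSolution (β - δ) (fun t n => dTerm β δ N (p t) n / N) w T a y ∧
            IsUniqueSolution (β - δ) (fun _ _ => 0) w T a f ∧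
            ∀ t ∈ Set.Icc 0 T, normL1 w (fun n => y t n - f t n) ≤ K / N) ∧
        -- in particular, for the moment vector itself
        (∀ f : ℝ → ℕ → ℝ, IsSolution (β - δ) (fun _ _ => 0) w T (moment N (p 0)) f →
          ∀ t ∈ Set.Icc 0 T, normL1 w (fun n => moment N (p t) n - f t n) ≤ K / N) := by
  have hqs : SignCond (β - δ) := ⟨hq, hsum⟩
  obtain ⟨Cβ, hCβ⟩ := isCompact_Icc.exists_bound_of_continuousOn
    (β.continuous.continuousOn (s := Set.Icc (0 : ℝ) 1))
  obtain ⟨Cδ, hCδ⟩ := isCompact_Icc.exists_bound_of_continuousOn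
    (δ.continuous.continuousOn (s := Set.Icc (0 : ℝ) 1))
  refine ⟨wt 4, wt_pos 4, fun T hT => ⟨(Cβ + Cδ) * (∑' n, wt 2 n) *
    Real.exp (growthRate (β - δ) 4 * T), fun N hN p hp => ?_⟩⟩
  have hp1 : ∀ t : ℝ, 0 ≤ t → ∑ k ∈ Finset.range (N + 1), |p t k| ≤ 1 := fun t ht =>
    sum_abs_chainLaw_le hβ hδ hβ1 hδ0 hN hp ht
  have hd_le : ∀ t : ℝ, 0 ≤ t → ∀ n : ℕ,
      |dTerm β δ N (p t) n| ≤ (Cβ + Cδ) * (n : ℝ) ^ 2 := fun t ht =>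
    abs_dTerm_le hβ1 hδ0 hCβ hCδ hN (hp1 t ht)
  have hdN : ∀ t ∈ Set.Icc 0 T, NormLE 4 (fun n => dTerm β δ N (p t) n / N)
      ((Cβ + Cδ) / N * ∑' n, wt 2 n) := fun t ht => normLE_four_of_abs_le fun n => by
    rw [abs_div, Nat.abs_cast, div_mul_eq_mul_div]
    exact div_le_div_of_nonneg_right (hd_le t ht.1 n) (Nat.cast_nonneg N)
  have hdz : ∀ t ∈ Set.Icc 0 T, dTerm β δ N (p t) 0 / N = 0 := fun t _ => by
    simp [dTerm, remR, remQ]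
  have hm : ∀ t ∈ Set.Icc 0 T, NormLE 2 (moment N (p t)) (1 * ∑' n, wt 2 n) := fun t ht =>
    normLE_moment (hp1 t ht.1)
  have hmode : ∀ n, ∀ t ∈ Set.Icc 0 T, HasDerivWithinAt (fun r => moment N (p r) n)
      (formalL (β - δ) (moment N (p t)) n + dTerm β δ N (p t) n / N) (Set.Icc 0 T) t :=
    fun n t ht => (hasDerivWithinAt_moment hβ1 hδ0 hN hp n ht.1).mono fun r hr => hr.1
  have hmc := (normContinuousOn_moment hp T).weaken (by norm_num : 2 ≤ 4)
  have hm0 : moment N (p 0) 0 = 1 := by simpa [moment] using hp.init_sum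
  obtain ⟨g, hg0, ⟨B, hgB⟩, hgode, hgc⟩ :=
    exists_solution hqs 0 hT.le (hm 0 ⟨le_rfl, hT.le⟩)
  have hgc' := hgc.weaken (by norm_num : 0 + 2 ≤ 4)
  have hgsol : IsSolution (β - δ) (fun _ _ => 0) (wt 4) T (moment N (p 0)) g :=
    isSolution_of_normLE hT.le (fun _ _ => rfl) hg0 hm0
      (fun t ht => ⟨B, (hgB t ht).weaken (by norm_num)⟩)
      (fun n t ht => by simpa using hgode n t ht) hgc'
  -- The moments and `g` are bounded with exponent `2`, so the estimate applies with exponent `4`.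
  have hmg : ∀ t ∈ Set.Icc 0 T, NormLE 4 (fun n => moment N (p t) n - g t n)
      ((Cβ + Cδ) * (∑' n, wt 2 n) * Real.exp (growthRate (β - δ) 4 * T) / N) := by
    intro t ht
    have h := normLE_of_formalL hqs (b := 2) (u := fun t n => moment N (p t) n - g t n)
      (s := fun t n => dTerm β δ N (p t) n / N) (A := 0) (T := T)
      (fun n t ht => ((hmode n t ht).sub (hgode n t ht)).congr_deriv
        (by rw [formalL_sub]; ring))
      (fun t ht => (hm t ht).sub (hgB t ht)) (by rw [hg0]; intro K; simp) hdN t ht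
    refine h.mono (le_of_eq ?_)
    ring
  refine ⟨fun t ht => (normLE_four_of_abs_le (hd_le t ht)).memL1,
    isSolution_of_normLE hT.le hdz rfl hm0
      (fun t ht => ⟨_, (hm t ht).weaken (by norm_num)⟩) hmode hmc, fun a ha haw => ?_,
    fun f hf t ht => ?_⟩
  · obtain ⟨f, hf0, ⟨B', hfB⟩, hfode, hfc⟩ := exists_solution hqs 2 hT.le (normLE_of_memL1 haw)
    have hfsol : IsSolution (β - δ) (fun _ _ => 0) (wt 4) T a f :=
      isSolution_of_normLE hT.le (fun _ _ => rfl) hf0 ha (fun t ht => ⟨B', hfB t ht⟩)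
        (fun n t ht => by simpa using hfode n t ht) hfc
    -- By linearity, `y - f` is the difference of the moments and `g`, whatever `a` is.
    have hysol : IsSolution (β - δ) (fun t n => dTerm β δ N (p t) n / N) (wt 4) T a
        (fun t n => f t n + (moment N (p t) n + -g t n)) := by
      refine isSolution_of_normLE hT.le hdz ?_ ha
        (fun t ht => ⟨_, (hfB t ht).add ((hmg t ht).of_abs_le fun n => by
          rw [← sub_eq_add_neg])⟩)
        (fun n t ht => ?_) (hfc.add (hmc.add hgc'.neg))
      · funext n
        rw [hf0, hg0, add_neg_cancel, add_zero]
      · simp only [← sub_eq_add_neg]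
        refine ((hfode n t ht).add ((hmode n t ht).sub (hgode n t ht))).congr_deriv ?_
        rw [formalL_add, formalL_sub]
        ring
    refine ⟨_, f, ⟨hysol, fun y' hy' => eq_of_isSolution hqs hy' hysol⟩,
      ⟨hfsol, fun f' hf' => eq_of_isSolution hqs hf' hfsol⟩, fun t ht => ?_⟩
    refine NormLE.normL1_le ((hmg t ht).of_abs_le fun n => le_of_eq ?_)
    congr 1
    ring
  · rw [eq_of_isSolution hqs hf hgsol t ht]
    exact (hmg t ht).normL1_le
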